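/- Let $m\ge 2$, let $e_1,\dots,e_m$ be an orthonormal basis of an $m$-dimensional complex Hilbert space $\mathcal H$, and put $e_0=\frac1{\sqrt m}\sum_{j=1}^m e_j$. Let $r_0\ge r_1\ge 0$ with $r_0+(m-1)r_1=1$, and let $$\psi_j=\sqrt{m r_1}\,e_j+(\sqrt{r_0}-\sqrt{r_1})\,e_0,\qquad j=1,\dots,m,$$ be the edges of the corresponding acute quantum pyramid (the orthogonal case $r_0=r_1$ and the degenerate case $r_1=0$ are included). Let $\mathcal E=\{\pi_j,\rho_j\}$ be the ensemble with $\pi_j=\frac1m$, $\rho_j=|\psi_j\rangle\langle\psi_j|$. For an observable $\mathcal M=\{M_k\}_{k}$ (finitely many operators $M_k\ge0$ on $\mathcal H$ with $\sum_kM_k=I$) put $p_{jk}=\pi_j\,\mathrm{Tr}\,\rho_jM_k$, $p_k=\sum_jp_{jk}$ and $I(\mathcal E,\mathcal M)=\sum_{j,k}p_{jk}\log\frac{p_{jk}}{\pi_jp_k}$, where $\log$ is the binary logarithm and $0\log(\cdot)=0$, and let $A(\mathcal E)=\sup_{\mathcal M}I(\mathcal E,\mathcal M)$ be the accessible information. Let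 $$t_a(m)=\begin{cases}1,& r_0\le \frac{4(m-1)}{m^2},\\[2pt] \frac{2(m-1)}{m-2}\sqrt{\frac{r_1}{r_0}},& r_0>\frac{4(m-1)}{m^2},\end{cases}$$ where the second case occurs only for $m\ge3$. Then $0\le t_a(m)\le1$, and, with $t=t_a(m)$, the Englert–Řeháček observable $M_k=|\tilde e_k\rangle\langle\tilde e_k|$, $k=0,1,\dots,m$, where $$\tilde e_0=\sqrt{1-t^2}\,e_0,\qquad \tilde e_k=e_k+\frac{t-1}{\sqrt m}\,e_0\quad(k=1,\dots,m),$$ is information-optimal: it attains $A(\mathcal E)$. Moreover, let $p=a^2$ with $a=\sqrt{mr_1}+\frac{\sqrt{r_0}-\sqrt{r_1}}{\sqrt m}=\langle e_j|\psi_j\rangle$. Then $p\in[\frac1m,1]$ and $$A(\mathcal E)=\begin{cases}\log m+p\log p+(1-p)\log\frac{1-p}{m-1},& p\in\left[\frac{m-1}m,1\right],\\[4pt] \frac{m-1}{m-2}\,\log(m-1)\left(\sqrt p-\sqrt{\frac{1-p}{m-1}}\right)^2,& m\ge3,\ p\in\left[\frac1m,\frac{m-1}m\right].\end{cases}$$ Equivalently,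 as conjectured by Englert and Řeháček, $$A(\mathcal E)=\begin{cases}\frac1m\left(\sqrt{r_0}+(m-1)\sqrt{r_1}\right)^2\log\left(\sqrt{r_0}+(m-1)\sqrt{r_1}\right)^2+\frac{m-1}m\left(\sqrt{r_0}-\sqrt{r_1}\right)^2\log\left(\sqrt{r_0}-\sqrt{r_1}\right)^2,& r_0\le\frac{4(m-1)}{m^2},\\[4pt] \frac{m(1-r_0)}{m-2}\log(m-1),& r_0>\frac{4(m-1)}{m^2}.\end{cases}$$ -/

import Mathlib

noncomputable section

/-- A finite ensemble `{π_j, ρ_j}`, `j = 1, …, m`, of quantum states on a finite-dimensional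
Hilbert space: a probability distribution together with density operators. -/
structure QEnsemble (H : Type*) [NormedAddCommGroup H] [InnerProductSpace ℂ H]
    [FiniteDimensional ℂ H] (m : ℕ) where
  prob : Fin m → ℝ
  state : Fin m → (H →L[ℂ] H)
  prob_nonneg : ∀ j, 0 ≤ prob j
  prob_sum : ∑ j, prob j = 1
  state_pos : ∀ j, (state j).IsPositive
  state_trace : ∀ j, LinearMap.trace ℂ H (state j).toLinearMap = 1

/-- A quantum observable with `n` outcomes: a resolution of the identity into positive
operators. -/
structure QObservable (H : Type*) [NormedAddCommGroup H] [InnerProductSpace ℂ H]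
    [FiniteDimensional ℂ H] (n : ℕ) where
  effect : Fin n → (H →L[ℂ] H)
  effect_pos : ∀ k, (effect k).IsPositive
  effect_sum : ∑ k, effect k = ContinuousLinearMap.id ℂ H

section Information

variable {H : Type*} [NormedAddCommGroup H] [InnerProductSpace ℂ H] [FiniteDimensional ℂ H]
  {m n : ℕ}

/-- The joint distribution `p_{jk} = π_j Tr ρ_j M_k` of input `j` and output `k`. -/
def jointProb (E : QEnsemble H m) (M : QObservable H n) (j : Fin m) (k : Fin n) : ℝ :=
  E.prob j * (LinearMap.trace ℂ H (E.state j ∘L M.effect k).toLinearMap).re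

/-- The distribution `p_k = ∑_j p_{jk}` of the output. -/
def outputProb (E : QEnsemble H m) (M : QObservable H n) (k : Fin n) : ℝ :=
  ∑ j, jointProb E M j k

/-- The Shannon mutual information (in bits) between input and output. The conventions
`x / 0 = 0` and `Real.logb 2 0 = 0` make the terms with `p_{jk} = 0` vanish, as usual. -/
def mutualInformation (E : QEnsemble H m) (M : QObservable H n) : ℝ :=
  ∑ j, ∑ k, jointProb E M j k *
    Real.logb 2 (jointProb E M j k / (E.prob j * outputProb E M k))

/-- The accessible information: the supremum of the mutual information over all observables
with any finite number of outcomes. -/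
def accessibleInformation (E : QEnsemble H m) : ℝ :=
  sSup {x : ℝ | ∃ (n : ℕ) (M : QObservable H n), x = mutualInformation E M}

/-- `M` is (globally) information-optimal for `E`: no observable, with any finite number of
outcomes, yields more mutual information. -/
def IsInformationOptimal (E : QEnsemble H m) (M : QObservable H n) : Prop :=
  ∀ (n' : ℕ) (N : QObservable H n'), mutualInformation E N ≤ mutualInformation E M

end Information

section Pyramid

variable {H : Type*} [NormedAddCommGroup H] [InnerProductSpace ℂ H] {m : ℕ}

/-- The symmetry axis `e₀ = m^{-1/2} ∑_j e_j`. -/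
def pyramidAxis (e : OrthonormalBasis (Fin m) ℂ H) : H :=
  (((1 / √(m : ℝ) : ℝ)) : ℂ) • ∑ j, e j

/-- The edges `ψ_j = √(m r₁) e_j + (√r₀ - √r₁) e₀` of the quantum pyramid. -/
def pyramidVector (e : OrthonormalBasis (Fin m) ℂ H) (r₀ r₁ : ℝ) (j : Fin m) : H :=
  ((√((m : ℝ) * r₁) : ℝ) : ℂ) • e j + ((√r₀ - √r₁ : ℝ) : ℂ) • pyramidAxis e

/-- The vectors `ẽ₀ = √(1 - t²) e₀` (index `0`) and `ẽ_k = e_k + ((t - 1) / √m) e₀`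
(index `k.succ`). -/
def erVector (e : OrthonormalBasis (Fin m) ℂ H) (t : ℝ) : Fin (m + 1) → H :=
  Fin.cons (((√(1 - t ^ 2) : ℝ) : ℂ) • pyramidAxis e)
    (fun k : Fin m => e k + (((t - 1) / √(m : ℝ) : ℝ) : ℂ) • pyramidAxis e)

theorem inner_basis_axis (e : OrthonormalBasis (Fin m) ℂ H) (j : Fin m) :
    inner ℂ (e j) (pyramidAxis e) = (((1 / √(m : ℝ) : ℝ)) : ℂ) := by
  simp [pyramidAxis, e.inner_eq_ite]

theorem inner_axis_basis (e : OrthonormalBasis (Fin m) ℂ H) (j : Fin m) :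
    inner ℂ (pyramidAxis e) (e j) = (((1 / √(m : ℝ) : ℝ)) : ℂ) := by
  rw [← inner_conj_symm, inner_basis_axis, Complex.conj_ofReal]

theorem sum_basis (e : OrthonormalBasis (Fin m) ℂ H) (hm : 2 ≤ m) :
    ∑ j, e j = ((√(m : ℝ) : ℝ) : ℂ) • pyramidAxis e := by
  have h : √(m : ℝ) ≠ 0 := by positivity
  rw [pyramidAxis, smul_smul, ← Complex.ofReal_mul, mul_one_div_cancel h, Complex.ofReal_one,
    one_smul]

theorem inner_axis_axis (e : OrthonormalBasis (Fin m) ℂ H) (hm : 2 ≤ m) :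
    inner ℂ (pyramidAxis e) (pyramidAxis e) = (1 : ℂ) := by
  have h0 : (0 : ℝ) < m := by positivity
  have h1 : (m : ℝ) * (1 / √(m : ℝ) * (1 / √(m : ℝ))) = 1 := by
    rw [div_mul_div_comm, Real.mul_self_sqrt h0.le]; field_simp
  nth_rw 2 [pyramidAxis]
  rw [inner_smul_right, inner_sum]
  simp only [inner_axis_basis, Finset.sum_const, Finset.card_univ, Fintype.card_fin,
    nsmul_eq_mul]
  calc _ = (((m : ℝ) * (1 / √(m : ℝ) * (1 / √(m : ℝ))) : ℝ) : ℂ) := by push_cast; ring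
    _ = 1 := by rw [h1, Complex.ofReal_one]

theorem inner_pyramidVector_self (e : OrthonormalBasis (Fin m) ℂ H) (hm : 2 ≤ m) {r₀ r₁ : ℝ}
    (hr₀ : 0 ≤ r₀) (hr₁ : 0 ≤ r₁) (hr : r₀ + ((m : ℝ) - 1) * r₁ = 1) (j : Fin m) :
    inner ℂ (pyramidVector e r₀ r₁ j) (pyramidVector e r₀ r₁ j) = (1 : ℂ) := by
  have h0 : (0 : ℝ) < m := by positivity
  have hs : √(m : ℝ) ≠ 0 := by positivity
  simp only [pyramidVector, inner_add_left, inner_add_right, inner_smul_left, inner_smul_right,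
    inner_basis_axis, inner_axis_basis, inner_axis_axis e hm, Complex.conj_ofReal,
    e.inner_eq_one]
  have key : √((m : ℝ) * r₁) * √((m : ℝ) * r₁) +
      2 * (√((m : ℝ) * r₁) * (√r₀ - √r₁) * (1 / √(m : ℝ))) + (√r₀ - √r₁) * (√r₀ - √r₁) = 1 := by
    rw [Real.mul_self_sqrt (by positivity), Real.sqrt_mul h0.le]
    have a0 := Real.mul_self_sqrt hr₀
    have a1 := Real.mul_self_sqrt hr₁
    field_simp
    linear_combination hr + a0 - a1
  have key' := congrArg (fun x : ℝ => (x : ℂ)) key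
  push_cast at key' ⊢
  linear_combination key'

variable [FiniteDimensional ℂ H]

/-- The ensemble of `m` equiprobable pure states `|ψ_j⟩⟨ψ_j|` of the quantum pyramid. -/
def pyramidEnsemble (e : OrthonormalBasis (Fin m) ℂ H) (hm : 2 ≤ m) {r₀ r₁ : ℝ}
    (hr₀ : 0 ≤ r₀) (hr₁ : 0 ≤ r₁) (hr : r₀ + ((m : ℝ) - 1) * r₁ = 1) : QEnsemble H m where
  prob := fun _ => 1 / (m : ℝ)
  state := fun j => InnerProductSpace.rankOne ℂ (pyramidVector e r₀ r₁ j) (pyramidVector e r₀ r₁ j)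
  prob_nonneg := fun _ => by positivity
  prob_sum := by
    have h : (m : ℝ) ≠ 0 := by positivity
    simp [h]
  state_pos := fun j => InnerProductSpace.isPositive_rankOne_self _
  state_trace := fun j => by
    rw [InnerProductSpace.trace_rankOne, inner_pyramidVector_self e hm hr₀ hr₁ hr]

/-- The Englert–Řeháček observable `M_k = |ẽ_k⟩⟨ẽ_k|`, `k = 0, 1, …, m`, with parameter
`0 ≤ t ≤ 1`. -/
def erObservable (e : OrthonormalBasis (Fin m) ℂ H) (hm : 2 ≤ m) {t : ℝ}
    (ht : t ∈ Set.Icc (0 : ℝ) 1) : QObservable H (m + 1) where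
  effect := fun k => InnerProductSpace.rankOne ℂ (erVector e t k) (erVector e t k)
  effect_pos := fun k => InnerProductSpace.isPositive_rankOne_self _
  effect_sum := by
    have h0 : (0 : ℝ) < m := by positivity
    have hs : √(m : ℝ) ≠ 0 := by positivity
    have ht2 : 0 ≤ 1 - t ^ 2 := by nlinarith [ht.1, ht.2]
    have h1 := e.sum_rankOne_eq_id
    rw [Fin.sum_univ_succ]
    simp only [erVector, Fin.cons_zero, Fin.cons_succ, map_add, add_apply,
      Finset.sum_add_distrib, h1]
    simp only [map_smulₛₗ, smul_apply, ← Finset.smul_sum, ← map_sum,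
      ← sum_apply, sum_basis e hm, Finset.sum_const, Finset.card_univ,
      Fintype.card_fin, RingHom.id_apply, Complex.conj_ofReal, smul_smul, ← Nat.cast_smul_eq_nsmul ℂ]
    have key : √(1 - t ^ 2) * √(1 - t ^ 2) + 2 * ((t - 1) / √(m : ℝ) * √(m : ℝ)) +
        (m : ℝ) * ((t - 1) / √(m : ℝ) * ((t - 1) / √(m : ℝ))) = 0 := by
      rw [Real.mul_self_sqrt ht2, div_mul_div_comm, Real.mul_self_sqrt h0.le]
      field_simp
      ring
    have key' := congrArg (fun x : ℝ => (x : ℂ)) key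
    push_cast at key' ⊢
    rw [map_natCast]
    generalize InnerProductSpace.rankOne ℂ (pyramidAxis e) (pyramidAxis e) = R
    have hR := congrArg (fun c : ℂ => ContinuousLinearMap.id ℂ H + c • R) key'
    simp only [zero_smul, add_zero] at hR
    refine Eq.trans ?_ hR
    module

end Pyramid

/-- The optimal parameter `t_a(m)` of the observable for an acute pyramid. -/
def optimalParameter (m : ℕ) (r₀ r₁ : ℝ) : ℝ :=
  if r₀ ≤ 4 * ((m : ℝ) - 1) / (m : ℝ) ^ 2 then 1
  else 2 * ((m : ℝ) - 1) / ((m : ℝ) - 2) * √(r₁ / r₀)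

/-- The parameter `p = a²`, where `a = √(m r₁) + (√r₀ - √r₁) / √m = ⟨e_j|ψ_j⟩`. -/
def pyramidP (m : ℕ) (r₀ r₁ : ℝ) : ℝ :=
  (√((m : ℝ) * r₁) + (√r₀ - √r₁) / √(m : ℝ)) ^ 2

/-- The mutual information of the square-root measurement, in terms of `r₀` and `r₁`. -/
def srmInformation (m : ℕ) (r₀ r₁ : ℝ) : ℝ :=
  1 / (m : ℝ) * (√r₀ + ((m : ℝ) - 1) * √r₁) ^ 2 *
      Real.logb 2 ((√r₀ + ((m : ℝ) - 1) * √r₁) ^ 2)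
    + ((m : ℝ) - 1) / (m : ℝ) * (√r₀ - √r₁) ^ 2 * Real.logb 2 ((√r₀ - √r₁) ^ 2)

end

/-! Optimality is proved by a Lagrangian bound. Writing each effect as `B†B`, an outcome gives
weights `v_j = ‖B ψ_j‖²`. Summed over outcomes, `∑ v_j` has total `m`, and `‖B (∑ ψ_j)‖²` has total
`‖∑ ψ_j‖² = m² r₀`, because the effects sum to the identity. By the triangle inequality, `(∑ √v_j)²`
has total at least `m² r₀`. It therefore suffices to bound the negative entropy of one outcome plus
`c` times its overlap `(∑ √v_j)² / ∑ v_j`, for a suitable `c ≥ 0`.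

For fixed `∑ √v_j` and `∑ v_j` the negative entropy is largest when `√v` is proportional to `(1, w,
…, w)` with `w ≤ 1` (`exists_twoLevel_sum_sq_mul_log_le`, by interpolating `x² log x` with a
parabola). What remains is the one-variable inequality `twoLevel_le`: with `n = m - 1`, every `w₀ ≤
1/n` with `w₀ < 1` maximizes negative entropy plus multiplier times overlap. Together these give
`sum_mul_log_div_le` and then `mutualInformation_mul_log_le`.

Let `a` and `b` be the coefficients of an edge along its own and the other basis vectors. If `n b ≤
a` and `b < a`, the choice `w₀ = b/a` makes the overlap equal to `m r₀`, and the bound is the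
information of the square-root measurement. Otherwise `w₀ = 1/n` is used. There the Lagrangian takes
the same value at `w = 1/n` and `w = 1`, so mixing informative outcomes of ratio `1/n` with one
uninformative outcome along the axis loses nothing; this is the observable with `t < 1`. -/

/-! ### The extremal problem for two-level vectors -/

/-- Minus the Shannon entropy (in nats) of the distribution proportional to
`(1, w², …, w²)`, with `n` entries `w²`. -/
noncomputable def twoLevelNegEntropy (n w : ℝ) : ℝ :=
  -Real.log (1 + n * w ^ 2) + 2 * n * w * (w * Real.log w) / (1 + n * w ^ 2)

/-- The squared overlap `(∑ x)² / ∑ x²` of the vector `(1, w, …, w)`, with `n` entries `w`. -/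
noncomputable def twoLevelOverlap (n w : ℝ) : ℝ := (1 + n * w) ^ 2 / (1 + n * w ^ 2)

/-- The Lagrange multiplier making `w` a critical point of
`twoLevelNegEntropy n + c • twoLevelOverlap n`. -/
noncomputable def twoLevelMultiplier (n w : ℝ) : ℝ :=
  -2 * (w * Real.log w) / ((1 - w) * (1 + n * w))

theorem log_le_half_sub_inv {u : ℝ} (hu : 1 ≤ u) : 2 * u * Real.log u ≤ u ^ 2 - 1 := by
  have h := Real.self_le_sinh_iff.2 (Real.log_nonneg hu)
  rw [Real.sinh_log (by linarith)] at h
  have hu0 : 0 < u := by linarith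
  have := mul_le_mul_of_nonneg_left h (by linarith : 0 ≤ 2 * u)
  have e : 2 * u * ((u - u⁻¹) / 2) = u ^ 2 - 1 := by field_simp
  linarith

/-- The difference of the two sides has derivative `-(1 - x)² / (x (1 + x)²)` and vanishes at `1`.
-/
theorem two_mul_one_sub_div_le_neg_log {w : ℝ} (h0 : 0 < w) (h1 : w ≤ 1) :
    2 * (1 - w) / (1 + w) ≤ -Real.log w := by
  have hanti : AntitoneOn (fun w : ℝ => -Real.log w - 2 * (1 - w) / (1 + w)) (Set.Ioi 0) := by
    have hd : ∀ x : ℝ, 0 < x → HasDerivAt (fun w : ℝ => -Real.log w - 2 * (1 - w) / (1 + w))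
        (-x⁻¹ - ((2 * (-1)) * (1 + x) - 2 * (1 - x) * 1) / (1 + x) ^ 2) x := by
      intro x hx
      have hx1 : 1 + x ≠ 0 := by positivity
      exact (Real.hasDerivAt_log hx.ne').neg.sub
        ((((hasDerivAt_id x).const_sub 1).const_mul 2).div ((hasDerivAt_id x).const_add 1) hx1)
    refine antitoneOn_of_deriv_nonpos (convex_Ioi 0)
      (fun x hx => (hd x hx).continuousAt.continuousWithinAt)
      (fun x hx => ?_) (fun x hx => ?_) <;> rw [interior_Ioi] at hx
    · exact (hd x hx).differentiableAt.differentiableWithinAt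
    · have hx : 0 < x := hx
      rw [(hd x hx).deriv]
      have : -x⁻¹ - ((2 * (-1)) * (1 + x) - 2 * (1 - x) * 1) / (1 + x) ^ 2
          = -((1 - x) ^ 2 / (x * (1 + x) ^ 2)) := by field_simp; ring
      rw [this]
      have : 0 ≤ (1 - x) ^ 2 / (x * (1 + x) ^ 2) := by positivity
      linarith
  have := hanti (show (0 : ℝ) < w from h0) (show (0 : ℝ) < 1 by norm_num) h1
  simp only [Real.log_one, sub_self, mul_zero, zero_div, neg_zero] at this
  linarith

/-- Convexity of `sinh` on the half-line, applied to the chord from the origin. -/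
theorem mul_sinh_le {s T : ℝ} (hs : 0 ≤ s) (hsT : s ≤ T) :
    T * Real.sinh s ≤ s * Real.sinh T := by
  rcases hs.eq_or_lt with rfl | hs0
  · simp
  have hconv : ConvexOn ℝ (Set.Ici 0) Real.sinh := by
    refine MonotoneOn.convexOn_of_deriv (convex_Ici 0) Real.continuous_sinh.continuousOn
      Real.differentiable_sinh.differentiableOn ?_
    rw [interior_Ici, Real.deriv_sinh]
    intro x hx y hy hxy
    have hx : 0 < x := hx
    have hy : 0 < y := hy
    rw [Real.cosh_le_cosh, abs_of_pos hx, abs_of_pos hy]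
    exact hxy
  have hT : 0 < T := by linarith
  have h := hconv.2 (show (0 : ℝ) ∈ Set.Ici 0 by simp) (show T ∈ Set.Ici (0 : ℝ) from hT.le)
    (show 0 ≤ 1 - s / T by rw [sub_nonneg, div_le_one hT]; exact hsT)
    (show 0 ≤ s / T by positivity) (by ring)
  simp only [smul_eq_mul, Real.sinh_zero, mul_zero, zero_add] at h
  rw [div_mul_cancel₀ _ hT.ne'] at h
  have := mul_le_mul_of_nonneg_left h hT.le
  have e : T * (s / T * Real.sinh T) = s * Real.sinh T := by field_simp
  linarith

/-- `(u - u⁻¹) / log u` is monotone in `u ≥ 1`. -/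
theorem log_mul_sub_inv_le {q u : ℝ} (hu : 1 ≤ u) (huq : u ≤ q) :
    Real.log q * (u - u⁻¹) ≤ Real.log u * (q - q⁻¹) := by
  have hu0 : 0 < u := by linarith
  have h := mul_sinh_le (Real.log_nonneg hu) (Real.log_le_log hu0 huq)
  rw [Real.sinh_log hu0, Real.sinh_log (by linarith)] at h
  linarith

/-- The numerator of the derivative simplifies to `-2 (1 - x)(1 + n x) - 2 (1 + n x²) log x`. Its
sign follows from the rational lower bound for `-log x`, and this is where `n x ≤ 1` enters. -/
theorem monotoneOn_twoLevelMultiplier {n w₀ : ℝ} (hn : 0 < n) (hw : w₀ < 1) (hnw : n * w₀ ≤ 1) :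
    MonotoneOn (twoLevelMultiplier n) (Set.Ioc 0 w₀) := by
  have hd : ∀ x : ℝ, 0 < x → x < 1 → HasDerivAt (twoLevelMultiplier n)
      (((-2 * (Real.log x + 1)) * ((1 - x) * (1 + n * x)) -
        -2 * (x * Real.log x) * ((-1) * (1 + n * x) + (1 - x) * (n * 1))) /
        ((1 - x) * (1 + n * x)) ^ 2) x := by
    intro x hx hx1
    have h1 : 0 < 1 - x := by linarith
    exact ((Real.hasDerivAt_mul_log hx.ne').const_mul (-2)).div
      (((hasDerivAt_id x).const_sub 1).mul (((hasDerivAt_id x).const_mul n).const_add 1))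
      (show (1 - x) * (1 + n * x) ≠ 0 by positivity)
  refine monotoneOn_of_deriv_nonneg (convex_Ioc 0 w₀)
      (fun x hx => (hd x hx.1 (by linarith [hx.2])).continuousAt.continuousWithinAt)
      (fun x hx => ?_) (fun x hx => ?_) <;> rw [interior_Ioc] at hx
  · exact (hd x hx.1 (by linarith [hx.2])).differentiableAt.differentiableWithinAt
  · have hx0 : 0 < x := hx.1
    have hx1 : x < 1 := by linarith [hx.2]
    rw [(hd x hx0 hx1).deriv]
    apply div_nonneg _ (sq_nonneg _)
    have hl := two_mul_one_sub_div_le_neg_log hx0 hx1.le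
    rw [div_le_iff₀ (by linarith)] at hl
    have hnx : n * x ≤ 1 := le_trans (mul_le_mul_of_nonneg_left hx.2.le hn.le) hnw
    have hlog : Real.log x < 0 := Real.log_neg hx0 hx1
    have key : (1 - x) * (1 + n * x) ≤ -Real.log x * (1 + n * x ^ 2) := by
      have h1 : (1 - x) * (1 + n * x) * (1 + x) ≤ 2 * (1 - x) * (1 + n * x ^ 2) := by
        have : 0 ≤ (1 - x) * ((1 - n * x) * (1 - x)) :=
          mul_nonneg (by linarith) (mul_nonneg (by linarith) (by linarith))
        nlinarith
      have h2 : 2 * (1 - x) * (1 + n * x ^ 2) ≤ -Real.log x * (1 + x) * (1 + n * x ^ 2) :=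
        mul_le_mul_of_nonneg_right hl (by positivity)
      have h3 : (1 - x) * (1 + n * x) * (1 + x) ≤ -Real.log x * (1 + n * x ^ 2) * (1 + x) := by
        linarith
      exact le_of_mul_le_mul_right h3 (by linarith)
    nlinarith

theorem twoLevelMultiplier_nonneg {n w : ℝ} (hn : 0 ≤ n) (h0 : 0 ≤ w) (h1 : w ≤ 1) :
    0 ≤ twoLevelMultiplier n w := by
  unfold twoLevelMultiplier
  have := Real.mul_log_nonpos h0 h1
  have h2 : 0 ≤ 1 - w := by linarith
  exact div_nonneg (by linarith) (by positivity)

theorem continuous_twoLevel {n : ℝ} (hn : 0 < n) (c : ℝ) :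
    Continuous (fun w => twoLevelNegEntropy n w + c * twoLevelOverlap n w) := by
  unfold twoLevelNegEntropy twoLevelOverlap
  have h : ∀ w : ℝ, 1 + n * w ^ 2 ≠ 0 := fun w => by positivity
  have hl := Real.continuous_mul_log
  refine Continuous.add (Continuous.add (Continuous.neg (Continuous.log (by fun_prop) h)) ?_) ?_
  · exact ((by fun_prop : Continuous fun w : ℝ => 2 * n * w).mul hl).div (by fun_prop) h
  · exact continuous_const.mul (Continuous.div (by fun_prop) (by fun_prop) h)

/-- For `0 < w < 1` the sign of this derivative is that of `c - twoLevelMultiplier n w`, so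
monotonicity of the objective becomes a comparison of multipliers. -/
theorem hasDerivAt_twoLevel {n : ℝ} (hn : 0 < n) (c : ℝ) {w : ℝ} (hw : 0 < w) :
    HasDerivAt (fun w => twoLevelNegEntropy n w + c * twoLevelOverlap n w)
      (2 * n * (c * ((1 - w) * (1 + n * w)) + 2 * (w * Real.log w)) / (1 + n * w ^ 2) ^ 2) w := by
  have h : 1 + n * w ^ 2 ≠ 0 := by positivity
  have hq : HasDerivAt (fun w : ℝ => 1 + n * w ^ 2) (n * (2 * w)) w := by
    simpa using ((hasDerivAt_pow 2 w).const_mul n).const_add 1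
  have hl : HasDerivAt (fun w : ℝ => 2 * n * w * (w * Real.log w))
      (2 * n * (w * Real.log w) + 2 * n * w * (Real.log w + 1)) w := by
    exact (((hasDerivAt_id w).const_mul (2 * n)).mul (Real.hasDerivAt_mul_log hw.ne')).congr_deriv
      (by simp)
  have hs : HasDerivAt (fun w : ℝ => (1 + n * w) ^ 2) (2 * (1 + n * w) * n) w := by
    exact ((((hasDerivAt_id w).const_mul n).const_add 1).pow 2).congr_deriv (by simp)
  have := ((hq.log h).neg.add (hl.div hq h)).add ((hs.div hq h).const_mul c)
  unfold twoLevelNegEntropy twoLevelOverlap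
  refine this.congr_deriv ?_
  field_simp
  ring

theorem twoLevel_monotoneOn {n : ℝ} (hn : 0 < n) {c a b : ℝ} (ha : 0 ≤ a)
    (h : ∀ w, a < w → w < b → -2 * (w * Real.log w) ≤ c * ((1 - w) * (1 + n * w))) :
    MonotoneOn (fun w => twoLevelNegEntropy n w + c * twoLevelOverlap n w) (Set.Icc a b) := by
  refine monotoneOn_of_deriv_nonneg (convex_Icc a b) (continuous_twoLevel hn c).continuousOn
    (fun x hx => ?_) (fun x hx => ?_) <;> rw [interior_Icc] at hx
  · exact (hasDerivAt_twoLevel hn c (by linarith [hx.1])).differentiableAt.differentiableWithinAt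
  · rw [(hasDerivAt_twoLevel hn c (by linarith [hx.1])).deriv]
    have := h x hx.1 hx.2
    exact div_nonneg (mul_nonneg (by positivity) (by linarith)) (by positivity)

theorem twoLevel_antitoneOn {n : ℝ} (hn : 0 < n) {c a b : ℝ} (ha : 0 ≤ a)
    (h : ∀ w, a < w → w < b → c * ((1 - w) * (1 + n * w)) ≤ -2 * (w * Real.log w)) :
    AntitoneOn (fun w => twoLevelNegEntropy n w + c * twoLevelOverlap n w) (Set.Icc a b) := by
  refine antitoneOn_of_deriv_nonpos (convex_Icc a b) (continuous_twoLevel hn c).continuousOn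
    (fun x hx => ?_) (fun x hx => ?_) <;> rw [interior_Icc] at hx
  · exact (hasDerivAt_twoLevel hn c (by linarith [hx.1])).differentiableAt.differentiableWithinAt
  · rw [(hasDerivAt_twoLevel hn c (by linarith [hx.1])).deriv]
    have := h x hx.1 hx.2
    exact div_nonpos_of_nonpos_of_nonneg
      (mul_nonpos_of_nonneg_of_nonpos (by positivity) (by linarith)) (by positivity)

theorem twoLevelMultiplier_inv {n : ℝ} (hn : 1 < n) :
    twoLevelMultiplier n n⁻¹ = Real.log n / (n - 1) := by
  unfold twoLevelMultiplier
  have h1 : n - 1 ≠ 0 := by linarith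
  have h0 : n ≠ 0 := by linarith
  rw [Real.log_inv]
  have e : (1 - n⁻¹) * (1 + n * n⁻¹) = 2 * (n - 1) / n := by field_simp; ring
  rw [e]; field_simp

theorem twoLevelOverlap_mono {n w₁ w₂ : ℝ} (hn : 0 ≤ n) (h0 : 0 ≤ w₁) (h12 : w₁ ≤ w₂)
    (h1 : w₂ ≤ 1) : twoLevelOverlap n w₁ ≤ twoLevelOverlap n w₂ := by
  unfold twoLevelOverlap
  have h2 : 0 ≤ w₂ := h0.trans h12
  rw [div_le_div_iff₀ (by positivity) (by positivity)]
  have : 0 ≤ n * (w₂ - w₁) * ((2 - w₁ - w₂) + n * (w₁ + w₂ - 2 * (w₁ * w₂))) := by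
    apply mul_nonneg (mul_nonneg hn (by linarith))
    have : 0 ≤ w₁ * (1 - w₂) + w₂ * (1 - w₁) :=
      add_nonneg (mul_nonneg h0 (by linarith)) (mul_nonneg h2 (by linarith))
    have : 0 ≤ n * (w₁ + w₂ - 2 * (w₁ * w₂)) := mul_nonneg hn (by linarith)
    linarith
  nlinarith

/-- The involution `w ↦ 1/(n w)` swaps the endpoints `1/n` and `1` and fixes `1/√n`. With the
multiplier of `1/n`, the objective decreases up to `1/√n`, then increases, and has equal values at
both endpoints, so its maximum is at the ends. -/
theorem twoLevel_le_inv {n : ℝ} (hn : 1 < n) {w : ℝ} (hw : n⁻¹ ≤ w) (hw1 : w ≤ 1) :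
    twoLevelNegEntropy n w + twoLevelMultiplier n n⁻¹ * twoLevelOverlap n w ≤
      twoLevelNegEntropy n n⁻¹ + twoLevelMultiplier n n⁻¹ * twoLevelOverlap n n⁻¹ := by
  have hn0 : 0 < n := by linarith
  have hq1 : 1 < √n := by rw [Real.lt_sqrt (by norm_num)]; linarith
  have hq0 : 0 < √n := by linarith
  have hqq : √n * √n = n := Real.mul_self_sqrt hn0.le
  have hlogq : Real.log n = 2 * Real.log √n := by
    nth_rw 1 [← hqq]; rw [Real.log_mul hq0.ne' hq0.ne']; ring
  have hc := twoLevelMultiplier_inv hn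
  set c := twoLevelMultiplier n n⁻¹
  have hcn : c * (√n - (√n)⁻¹) * √n = Real.log n := by
    rw [hc, mul_assoc, sub_mul, hqq, inv_mul_cancel₀ hq0.ne', div_mul_cancel₀]; linarith
  have hcq : c * √n * (√n - (√n)⁻¹) = 2 * Real.log √n := by rw [← hlogq, ← hcn]; ring
  -- In the variable `u = 1/(x √n)`, the terms `c (n - 1)` and `2 log √n` cancel in the derivative
  -- condition. What is left compares `c √n (u - u⁻¹)` with `2 log u`, with equality at `u = √n`.
  have hkey : ∀ x : ℝ, 0 < x → (1 - x) * (1 + n * x) =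
      x * ((n - 1) + √n * ((x * √n)⁻¹ - x * √n)) := by
    intro x hx
    have : √n * ((x * √n)⁻¹ - x * √n) = x⁻¹ - x * n := by
      have e1 : √n * (x * √n)⁻¹ = x⁻¹ := by field_simp
      rw [mul_sub, e1]; linear_combination -x * hqq
    rw [this]; field_simp; ring
  have hd0 : 0 < √n - (√n)⁻¹ := by
    have : (√n)⁻¹ < 1 := inv_lt_one_of_one_lt₀ hq1
    linarith
  have hlogx : ∀ x : ℝ, 0 < x → Real.log x = -Real.log ((x * √n)⁻¹) - Real.log √n := by
    intro x hx
    rw [Real.log_inv, Real.log_mul hx.ne' hq0.ne']; ring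
  have hcn1 : c * (n - 1) = 2 * Real.log √n := by
    rw [hc, div_mul_cancel₀ _ (by linarith), hlogq]
  have hleft : ∀ x, n⁻¹ ≤ x → x ≤ (√n)⁻¹ →
      c * ((1 - x) * (1 + n * x)) ≤ -2 * (x * Real.log x) := by
    intro x hx hx'
    have hx0 : 0 < x := lt_of_lt_of_le (by positivity) hx
    have hu1 : 1 ≤ (x * √n)⁻¹ := by
      rw [one_le_inv₀ (by positivity)]
      calc x * √n ≤ (√n)⁻¹ * √n := by gcongr
        _ = 1 := inv_mul_cancel₀ hq0.ne'
    have huq : (x * √n)⁻¹ ≤ √n := by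
      rw [inv_le_comm₀ (by positivity) hq0]
      calc (√n)⁻¹ = n⁻¹ * √n := by nth_rw 2 [← hqq]; field_simp
        _ ≤ x * √n := by gcongr
    have h := log_mul_sub_inv_le hu1 huq
    rw [inv_inv] at h
    have h2 : c * √n * ((x * √n)⁻¹ - x * √n) ≤ 2 * Real.log ((x * √n)⁻¹) := by
      refine le_of_mul_le_mul_right ?_ hd0
      calc c * √n * ((x * √n)⁻¹ - x * √n) * (√n - (√n)⁻¹)
          = 2 * (Real.log √n * ((x * √n)⁻¹ - x * √n)) := by rw [← mul_assoc, ← hcq]; ring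
        _ ≤ 2 * Real.log ((x * √n)⁻¹) * (√n - (√n)⁻¹) := by linarith
    rw [hkey x hx0, hlogx x hx0]
    have := mul_le_mul_of_nonneg_left h2 hx0.le
    nlinarith
  have hright : ∀ x, (√n)⁻¹ ≤ x → x ≤ 1 →
      -2 * (x * Real.log x) ≤ c * ((1 - x) * (1 + n * x)) := by
    intro x hx hx'
    have hx0 : 0 < x := lt_of_lt_of_le (by positivity) hx
    have hu1 : 1 ≤ x * √n := by
      calc (1 : ℝ) = (√n)⁻¹ * √n := (inv_mul_cancel₀ hq0.ne').symm
        _ ≤ x * √n := by gcongr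
    have huq : x * √n ≤ √n := by nlinarith
    have h := log_mul_sub_inv_le hu1 huq
    have h2 : 2 * Real.log ((x * √n)⁻¹) ≤ c * √n * ((x * √n)⁻¹ - x * √n) := by
      refine le_of_mul_le_mul_right ?_ hd0
      calc 2 * Real.log ((x * √n)⁻¹) * (√n - (√n)⁻¹)
          ≤ 2 * (Real.log √n * ((x * √n)⁻¹ - x * √n)) := by rw [Real.log_inv]; linarith
        _ = c * √n * ((x * √n)⁻¹ - x * √n) * (√n - (√n)⁻¹) := by rw [← mul_assoc, ← hcq]; ring
    rw [hkey x hx0, hlogx x hx0]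
    have := mul_le_mul_of_nonneg_left h2 hx0.le
    nlinarith
  have hq2 : n⁻¹ ≤ (√n)⁻¹ := by
    apply inv_anti₀ hq0; nlinarith
  have hends : twoLevelNegEntropy n 1 + c * twoLevelOverlap n 1 =
      twoLevelNegEntropy n n⁻¹ + c * twoLevelOverlap n n⁻¹ := by
    unfold twoLevelNegEntropy twoLevelOverlap
    have e1 : 1 + n * n⁻¹ ^ 2 = (1 + n) / n := by field_simp; ring
    have e2 : n * n⁻¹ = 1 := mul_inv_cancel₀ hn0.ne'
    rw [e1, hc, Real.log_div (by positivity) hn0.ne', Real.log_inv, e2]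
    have : n - 1 ≠ 0 := by linarith
    simp only [Real.log_one]
    field_simp
    ring
  rcases le_total w (√n)⁻¹ with h | h
  · exact twoLevel_antitoneOn hn0 (by positivity) (fun x h1 h2 => hleft x h1.le h2.le)
      (Set.left_mem_Icc.2 hq2) ⟨hw, h⟩ hw
  · rw [← hends]
    exact twoLevel_monotoneOn hn0 (by positivity) (fun x h1 h2 => hright x h1.le h2.le)
      ⟨h, hw1⟩ (Set.right_mem_Icc.2 (h.trans hw1)) hw1

/-- The tangent line inequality between the entropy and the overlap of a two-level vector. -/
theorem twoLevel_le {n w₀ w : ℝ} (hn : 1 ≤ n) (h0 : 0 ≤ w₀) (h1 : w₀ < 1) (hnw : n * w₀ ≤ 1)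
    (hw0 : 0 ≤ w) (hw1 : w ≤ 1) :
    twoLevelNegEntropy n w + twoLevelMultiplier n w₀ * twoLevelOverlap n w ≤
      twoLevelNegEntropy n w₀ + twoLevelMultiplier n w₀ * twoLevelOverlap n w₀ := by
  have hn0 : 0 < n := by linarith
  have hinv1 : n⁻¹ ≤ 1 := inv_le_one_of_one_le₀ hn
  have hw0inv : w₀ ≤ n⁻¹ := by rw [← one_div, le_div_iff₀ hn0]; linarith
  have hdef : ∀ x, 0 ≤ x → x < 1 →
      twoLevelMultiplier n x * ((1 - x) * (1 + n * x)) = -2 * (x * Real.log x) := by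
    intro x hx hx1
    have : 0 < 1 - x := by linarith
    unfold twoLevelMultiplier
    rw [div_mul_cancel₀]; positivity
  have hmono : ∀ x y, 0 ≤ x → x ≤ y → y < 1 → y ≤ n⁻¹ →
      twoLevelMultiplier n x ≤ twoLevelMultiplier n y := by
    intro x y hx hxy hy1 hyn
    -- The endpoint `0` is outside the differentiable range; the multiplier vanishes there since
    -- `log 0 = 0`.
    rcases hx.eq_or_lt with rfl | hx
    · have : twoLevelMultiplier n 0 = 0 := by simp [twoLevelMultiplier]
      rw [this]; exact twoLevelMultiplier_nonneg hn0.le hxy hy1.le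
    · refine monotoneOn_twoLevelMultiplier hn0 hy1 ?_ ⟨hx, hxy⟩ ⟨hx.trans_le hxy, le_rfl⟩ hxy
      calc n * y ≤ n * n⁻¹ := by gcongr
        _ = 1 := mul_inv_cancel₀ hn0.ne'
  have hmid : ∀ x, w₀ ≤ x → x ≤ n⁻¹ →
      twoLevelNegEntropy n x + twoLevelMultiplier n w₀ * twoLevelOverlap n x ≤
      twoLevelNegEntropy n w₀ + twoLevelMultiplier n w₀ * twoLevelOverlap n w₀ := by
    intro x hx hxn
    refine twoLevel_antitoneOn (b := n⁻¹) hn0 h0 (fun y hy hyn => ?_)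
      (Set.left_mem_Icc.2 hw0inv) ⟨hx, hxn⟩ hx
    have hy1 : y < 1 := by linarith
    have : 0 < 1 - y := by linarith
    rw [← hdef y (by linarith) hy1]
    have hy0 : 0 ≤ y := by linarith
    exact mul_le_mul_of_nonneg_right (hmono w₀ y h0 hy.le hy1 hyn.le) (by positivity)
  rcases le_total w w₀ with h | h
  · refine twoLevel_monotoneOn (a := 0) hn0 le_rfl (fun y hy hyn => ?_) ⟨hw0, h⟩
      (Set.right_mem_Icc.2 h0) h
    have : 0 < 1 - y := by linarith
    rw [← hdef y hy.le (by linarith)]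
    exact mul_le_mul_of_nonneg_right (hmono y w₀ hy.le hyn.le h1 hw0inv) (by positivity)
  rcases le_total w n⁻¹ with h' | h'
  · exact hmid w h h'
  rcases hn.eq_or_lt with rfl | hn1
  · rw [inv_one] at h'
    exact hmid w h (by rw [inv_one]; exact hw1)
  -- Beyond `1/n` the multiplier need not be monotone, so the comparison passes through the point
  -- `1/n`. Lowering the multiplier from that of `1/n` to that of `w₀` only helps, because the
  -- overlap at `w` is at least the overlap at `1/n`.
  have hI := hmid n⁻¹ hw0inv le_rfl
  have hJ := twoLevel_le_inv hn1 h' hw1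
  have hc := hmono w₀ n⁻¹ h0 hw0inv (inv_lt_one_of_one_lt₀ hn1) le_rfl
  have hs := twoLevelOverlap_mono hn0.le (by positivity) h' hw1
  nlinarith [mul_nonneg (sub_nonneg.2 hc) (sub_nonneg.2 hs)]

/-! ### Reduction of arbitrary vectors to two-level vectors -/

/-- This compares `u² log u` with its second-order Taylor polynomial at `1`: the derivative of the
remainder is `2 (u log u - (u - 1)) ≥ 0`, and the remainder vanishes at `1`. -/
theorem monotoneOn_sq_mul_log_sub :
    MonotoneOn (fun u : ℝ => u ^ 2 * Real.log u - (u - 1) - 3 / 2 * (u - 1) ^ 2) (Set.Ioi 0) := by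
  have hd : ∀ x : ℝ, 0 < x → HasDerivAt
      (fun u : ℝ => u ^ 2 * Real.log u - (u - 1) - 3 / 2 * (u - 1) ^ 2)
      (2 * (x * Real.log x - (x - 1))) x := by
    intro x hx
    have h := ((((hasDerivAt_pow 2 x).mul (Real.hasDerivAt_log hx.ne')).sub
      ((hasDerivAt_id x).sub_const 1)).sub
      ((((hasDerivAt_id x).sub_const 1).pow 2).const_mul (3 / 2)))
    refine h.congr_deriv ?_
    simp only [id]
    field_simp
    ring
  refine monotoneOn_of_deriv_nonneg (convex_Ioi 0)
      (fun x hx => (hd x hx).continuousAt.continuousWithinAt)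
      (fun x hx => ?_) (fun x hx => ?_) <;> rw [interior_Ioi] at hx
  · exact (hd x hx).differentiableAt.differentiableWithinAt
  · rw [(hd x hx).deriv]
    have := Real.self_sub_one_le_mul_log (le_of_lt (show 0 < x from hx))
    linarith

/-- The derivative has the sign of `u² - 1 - 2 u log u`, controlled by `log_le_half_sub_inv`. The
quotient is the quadratic coefficient of the parabola tangent at `1` and passing through the graph
at `u`. -/
theorem monotoneOn_sq_mul_log_sub_div :
    MonotoneOn (fun u : ℝ => (u ^ 2 * Real.log u - (u - 1)) / (u - 1) ^ 2) (Set.Ioi 1) := by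
  have hd : ∀ x : ℝ, 1 < x → HasDerivAt
      (fun u : ℝ => (u ^ 2 * Real.log u - (u - 1)) / (u - 1) ^ 2)
      ((x ^ 2 - 1 - 2 * x * Real.log x) / (x - 1) ^ 3) x := by
    intro x hx
    have hx0 : x ≠ 0 := by linarith
    have hx1 : x - 1 ≠ 0 := by linarith
    have h := (((hasDerivAt_pow 2 x).mul (Real.hasDerivAt_log hx0)).sub
      ((hasDerivAt_id x).sub_const 1)).div
      (((hasDerivAt_id x).sub_const 1).pow 2) (pow_ne_zero 2 hx1)
    refine h.congr_deriv ?_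
    simp only [id, Pi.pow_apply, Pi.sub_apply, Pi.mul_apply]
    field_simp
    ring
  refine monotoneOn_of_deriv_nonneg (convex_Ioi 1)
      (fun x hx => (hd x hx).continuousAt.continuousWithinAt)
      (fun x hx => ?_) (fun x hx => ?_) <;> rw [interior_Ioi] at hx
  · exact (hd x hx).differentiableAt.differentiableWithinAt
  · have hx : 1 < x := hx
    rw [(hd x hx).deriv]
    have := log_le_half_sub_inv hx.le
    exact div_nonneg (by linarith) (pow_nonneg (by linarith) 3)

/-- Hermite interpolation of `x² log x`: the parabola tangent at `b` and passing through the
point at `a` lies above the graph on `[0, a]`. -/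
theorem exists_quadratic_ge_sq_mul_log {a b : ℝ} (hb : 0 < b) (hab : b < a) :
    ∃ α β γ : ℝ, (∀ x, 0 ≤ x → x ≤ a → x ^ 2 * Real.log x ≤ α + β * x + γ * x ^ 2) ∧
      a ^ 2 * Real.log a = α + β * a + γ * a ^ 2 ∧
      b ^ 2 * Real.log b = α + β * b + γ * b ^ 2 := by
  have hA : 1 < a / b := by rwa [one_lt_div hb]
  -- Rescaling by `u = x / b` moves the tangency point to `1`; this `κ` makes the parabola pass
  -- through the graph at `a / b`.
  set κ := ((a / b) ^ 2 * Real.log (a / b) - (a / b - 1)) / (a / b - 1) ^ 2 with hκ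
  have hT1 : ∀ u : ℝ, 0 ≤ u → u ≤ 1 →
      u ^ 2 * Real.log u ≤ (u - 1) + 3 / 2 * (u - 1) ^ 2 := by
    intro u hu hu1
    rcases hu.eq_or_lt with rfl | hu0
    · norm_num
    have := monotoneOn_sq_mul_log_sub (show (0 : ℝ) < u from hu0)
      (show (0 : ℝ) < 1 by norm_num) hu1
    simp only [Real.log_one] at this
    linarith
  -- Since `κ` is at least the Taylor coefficient `3/2`, the parabola also dominates to the left of
  -- the tangency point.
  have hκ1 : 3 / 2 ≤ κ := by
    have := monotoneOn_sq_mul_log_sub (show (0 : ℝ) < 1 by norm_num)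
      (show (0 : ℝ) < a / b by linarith) hA.le
    simp only [Real.log_one] at this
    have hp : 0 < (a / b - 1) ^ 2 := pow_pos (by linarith) 2
    rw [hκ, le_div_iff₀ hp]
    linarith
  have hu : ∀ u : ℝ, 0 ≤ u → u ≤ a / b → u ^ 2 * Real.log u ≤ (u - 1) + κ * (u - 1) ^ 2 := by
    intro u hu0 huA
    rcases le_or_gt u 1 with h | h
    · have := mul_le_mul_of_nonneg_right hκ1 (sq_nonneg (u - 1))
      linarith [hT1 u hu0 h]
    · have := monotoneOn_sq_mul_log_sub_div (show 1 < u from h) (show 1 < a / b from hA) huA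
      have hp : 0 < (u - 1) ^ 2 := pow_pos (by linarith) 2
      have this : (u ^ 2 * Real.log u - (u - 1)) / (u - 1) ^ 2 ≤ κ := this
      rw [div_le_iff₀ hp] at this
      linarith
  have hAeq : (a / b) ^ 2 * Real.log (a / b) = (a / b - 1) + κ * (a / b - 1) ^ 2 := by
    have hp : (a / b - 1) ^ 2 ≠ 0 := (pow_pos (by linarith) 2).ne'
    rw [hκ, div_mul_cancel₀ _ hp]; ring
  have hq : ∀ x, b ^ 2 * ((x / b - 1) + κ * (x / b - 1) ^ 2) + x ^ 2 * Real.log b =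
      b ^ 2 * (κ - 1) + (b * (1 - 2 * κ)) * x + (κ + Real.log b) * x ^ 2 := by
    intro x; field_simp; ring
  have hg : ∀ x, 0 ≤ x → x ^ 2 * Real.log x =
      b ^ 2 * ((x / b) ^ 2 * Real.log (x / b)) + x ^ 2 * Real.log b := by
    intro x hx
    rcases hx.eq_or_lt with rfl | hx0
    · simp
    rw [Real.log_div hx0.ne' hb.ne']; field_simp; ring
  refine ⟨b ^ 2 * (κ - 1), b * (1 - 2 * κ), κ + Real.log b, fun x hx hxa => ?_, ?_, ?_⟩
  · rw [← hq, hg x hx]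
    have := hu (x / b) (by positivity) (by gcongr)
    have := mul_le_mul_of_nonneg_left this (sq_nonneg b)
    linarith
  · rw [← hq, hg a (by linarith), hAeq]
  · ring

/-- Among nonnegative vectors with given `∑ x` and `∑ x²`, the sum `∑ x² log x` is largest for a
two-level vector with a single large entry. -/
theorem exists_twoLevel_sum_sq_mul_log_le {ι : Type*} [Fintype ι] {n : ℝ}
    (hn : (Fintype.card ι : ℝ) = n + 1) (hn0 : 0 < n) (x : ι → ℝ) (hx : ∀ j, 0 ≤ x j) :
    ∃ a b : ℝ, 0 ≤ b ∧ b ≤ a ∧ a + n * b = ∑ j, x j ∧ a ^ 2 + n * b ^ 2 = ∑ j, x j ^ 2 ∧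
      ∑ j, x j ^ 2 * Real.log (x j) ≤ a ^ 2 * Real.log a + n * (b ^ 2 * Real.log b) := by
  set S := ∑ j, x j with hS
  set Q := ∑ j, x j ^ 2 with hQ
  have hS0 : 0 ≤ S := Finset.sum_nonneg fun j _ => hx j
  have hSQ : S ^ 2 ≤ (n + 1) * Q := by
    rw [← hn]; simpa using sq_sum_le_card_mul_sum_sq (s := Finset.univ) (f := x)
  have hQS : Q ≤ S ^ 2 := by
    rw [hQ, hS]; exact Finset.sum_sq_le_sq_sum_of_nonneg fun j _ => hx j
  -- `δ` is the gap `a - b` forced by `a + n b = S` and `a² + n b² = Q`.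
  set δ := √(((n + 1) * Q - S ^ 2) / n) with hδ
  have hδ0 : 0 ≤ δ := Real.sqrt_nonneg _
  have hδ2 : n * δ ^ 2 = (n + 1) * Q - S ^ 2 := by
    rw [hδ, Real.sq_sqrt (div_nonneg (by linarith) hn0.le)]; field_simp
  -- Equivalent to `Q ≤ S²`; it makes the small entry `b` nonnegative.
  have hδS : δ ≤ S := by
    refine abs_le_of_sq_le_sq' ?_ hS0 |>.2
    nlinarith
  have hn1 : 0 < n + 1 := by linarith
  set a := (S + n * δ) / (n + 1) with ha
  set b := (S - δ) / (n + 1) with hb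
  have hab : a - b = δ := by rw [ha, hb]; field_simp; ring
  have h1 : a + n * b = S := by rw [ha, hb]; field_simp; ring
  have h2 : a ^ 2 + n * b ^ 2 = Q := by
    rw [ha, hb]; field_simp; linear_combination (n+1) * hδ2
  have hb0 : 0 ≤ b := div_nonneg (by linarith) hn1.le
  -- Cauchy–Schwarz on the other `n` entries: `(S - x_j)² ≤ n (Q - x_j²)`.
  have hxa : ∀ j, x j ≤ a := by
    intro j
    classical
    have e1 : S - x j = ∑ i ∈ Finset.univ.erase j, x i := by
      rw [hS, ← Finset.add_sum_erase _ _ (Finset.mem_univ j)]; ring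
    have e2 : Q - x j ^ 2 = ∑ i ∈ Finset.univ.erase j, x i ^ 2 := by
      rw [hQ, ← Finset.add_sum_erase _ _ (Finset.mem_univ j)]; ring
    have hc : (((Finset.univ.erase j).card : ℕ) : ℝ) = n := by
      rw [Finset.card_erase_of_mem (Finset.mem_univ j), Finset.card_univ,
        Nat.cast_sub (Fintype.card_pos_iff.2 ⟨j⟩), hn]; simp
    have hcs := sq_sum_le_card_mul_sum_sq (s := Finset.univ.erase j) (f := x)
    rw [← e1, ← e2, hc] at hcs
    have h3 : ((n + 1) * x j - S) ^ 2 ≤ (n * δ) ^ 2 := by nlinarith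
    have h4 := abs_le_of_sq_le_sq' h3 (by positivity)
    rw [ha, le_div_iff₀ hn1]; linarith [h4.2]
  refine ⟨a, b, hb0, by linarith, h1, h2, ?_⟩
  -- This crude bound is already sharp when `b = 0` or `a = b`, where the interpolation is
  -- unavailable.
  have htriv : ∑ j, x j ^ 2 * Real.log (x j) ≤ Q * Real.log a := by
    rw [hQ, Finset.sum_mul]
    refine Finset.sum_le_sum fun j _ => ?_
    rcases (hx j).eq_or_lt with h | h
    · rw [← h]; simp
    · exact mul_le_mul_of_nonneg_left (Real.log_le_log h (hxa j)) (sq_nonneg _)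
  rcases hb0.eq_or_lt with hb00 | hb1
  · rw [← hb00] at h2 ⊢
    rw [← h2] at htriv
    simpa using htriv
  have hba : b ≤ a := by linarith
  rcases hba.eq_or_lt with hba | hba
  · rw [hba] at h2 ⊢
    rw [← h2] at htriv
    linarith
  · obtain ⟨α, β, γ, hle, hea, heb⟩ := exists_quadratic_ge_sq_mul_log hb1 hba
    -- The sum of the parabola depends only on `S` and `Q`, and the two-level vector lies on its
    -- contact points.
    calc ∑ j, x j ^ 2 * Real.log (x j) ≤ ∑ j, (α + β * x j + γ * x j ^ 2) :=
          Finset.sum_le_sum fun j _ => hle _ (hx j) (hxa j)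
      _ = (n + 1) * α + β * S + γ * Q := by
          rw [Finset.sum_add_distrib, Finset.sum_add_distrib, ← Finset.mul_sum, ← Finset.mul_sum,
            Finset.sum_const, Finset.card_univ, nsmul_eq_mul, hn]
      _ = a ^ 2 * Real.log a + n * (b ^ 2 * Real.log b) := by
          rw [hea, heb, ← h1, ← h2]; ring

/-- The entropy of a distribution is controlled by the overlap of its square root with the
uniform vector. -/
theorem sum_mul_log_div_le {ι : Type*} [Fintype ι] {n w₀ : ℝ}
    (hn : (Fintype.card ι : ℝ) = n + 1) (hn1 : 1 ≤ n) (h0 : 0 ≤ w₀) (h1 : w₀ < 1)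
    (hnw : n * w₀ ≤ 1) (v : ι → ℝ) (hv : ∀ j, 0 ≤ v j) :
    ∑ j, v j * Real.log (v j / ∑ i, v i) + twoLevelMultiplier n w₀ * (∑ j, √(v j)) ^ 2 ≤
      (twoLevelNegEntropy n w₀ + twoLevelMultiplier n w₀ * twoLevelOverlap n w₀) * ∑ j, v j := by
  have hn0 : 0 < n := by linarith
  obtain ⟨a, b, hb, hab, hS, hQ, hle⟩ := exists_twoLevel_sum_sq_mul_log_le hn hn0
    (fun j => √(v j)) (fun j => Real.sqrt_nonneg _)
  simp only [Real.sq_sqrt (hv _), Real.log_sqrt (hv _)] at hQ hle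
  set V := ∑ j, v j with hV
  have hV0 : 0 ≤ V := Finset.sum_nonneg fun j _ => hv j
  rcases hV0.eq_or_lt with hV00 | hVpos
  · have hz : ∀ j, v j = 0 := fun j =>
      (Finset.sum_eq_zero_iff_of_nonneg (fun j _ => hv j)).1 hV00.symm j (Finset.mem_univ j)
    rw [← hV00]
    simp [hz]
  have ha : 0 < a := by
    rcases (hb.trans hab).eq_or_lt with h | h
    · have : b = 0 := by linarith
      rw [← h, this] at hQ; norm_num at hQ; linarith
    · exact h
  have hlin : ∑ j, v j * Real.log (v j / V) = ∑ j, v j * Real.log (v j) - V * Real.log V := by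
    have : V * Real.log V = ∑ j, v j * Real.log V := by rw [hV, Finset.sum_mul]
    rw [this, ← Finset.sum_sub_distrib]
    refine Finset.sum_congr rfl fun j _ => ?_
    rcases (hv j).eq_or_lt with h | h
    · rw [← h]; simp
    · rw [Real.log_div h.ne' hVpos.ne']; ring
  have hhalf : ∑ j, v j * (Real.log (v j) / 2) = (∑ j, v j * Real.log (v j)) / 2 := by
    rw [Finset.sum_div]; exact Finset.sum_congr rfl fun j _ => by ring
  rw [hhalf] at hle
  have hov : twoLevelOverlap n (b / a) * V = (∑ j, √(v j)) ^ 2 := by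
    rw [← hS, ← hQ, twoLevelOverlap]
    have : 1 + n * (b / a) ^ 2 = (a ^ 2 + n * b ^ 2) / a ^ 2 := by field_simp
    rw [this]; field_simp
  have hent : ∑ j, v j * Real.log (v j / V) ≤ twoLevelNegEntropy n (b / a) * V := by
    have e1 : 1 + n * (b / a) ^ 2 = V / a ^ 2 := by rw [← hQ]; field_simp
    have e2 : b ^ 2 * Real.log b = b ^ 2 * Real.log (b / a) + b ^ 2 * Real.log a := by
      rcases hb.eq_or_lt with h | h
      · rw [← h]; simp
      · rw [Real.log_div h.ne' ha.ne']; ring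
    have e3 : twoLevelNegEntropy n (b / a) * V =
        V * (2 * Real.log a - Real.log V) + 2 * n * (b ^ 2 * Real.log (b / a)) := by
      rw [twoLevelNegEntropy, e1, Real.log_div hVpos.ne' (by positivity), Real.log_pow]
      field_simp
      push_cast
      ring
    rw [hlin, e3]
    have e4 : V * Real.log a = a ^ 2 * Real.log a + n * (b ^ 2 * Real.log a) := by
      rw [← hQ]; ring
    linear_combination 2 * hle + 2 * n * e2 - 2 * e4
  have htl := twoLevel_le hn1 h0 h1 hnw (div_nonneg hb ha.le) ((div_le_one ha).2 hab)
  have := mul_le_mul_of_nonneg_right htl hVpos.le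
  rw [← hov]
  linear_combination hent + this

/-! ### Measurement statistics of the pyramid -/

section Quantum

variable {H : Type*} [NormedAddCommGroup H] [InnerProductSpace ℂ H] {m k : ℕ}

theorem norm_sum_pyramidVector (e : OrthonormalBasis (Fin m) ℂ H) (hm : 2 ≤ m) {r₀ r₁ : ℝ}
    (hr₀ : 0 ≤ r₀) : ‖∑ j, pyramidVector e r₀ r₁ j‖ ^ 2 = (m : ℝ) ^ 2 * r₀ := by
  have h0 : (0 : ℝ) < m := by positivity
  have hsum : ∑ j, pyramidVector e r₀ r₁ j = ((m * √r₀ : ℝ) : ℂ) • pyramidAxis e := by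
    simp only [pyramidVector, Finset.sum_add_distrib, ← Finset.smul_sum, sum_basis e hm,
      Finset.sum_const, Finset.card_univ, Fintype.card_fin, smul_smul,
      ← Nat.cast_smul_eq_nsmul ℂ, ← add_smul]
    congr 1
    have : √((m : ℝ) * r₁) * √m + (√r₀ - √r₁) * m = m * √r₀ := by
      rw [Real.sqrt_mul h0.le]
      linear_combination √r₁ * Real.mul_self_sqrt h0.le
    exact_mod_cast this
  have hax : ‖pyramidAxis e‖ ^ 2 = 1 := by
    rw [← inner_self_eq_norm_sq (𝕜 := ℂ), inner_axis_axis e hm]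
    rfl
  rw [hsum, norm_smul, mul_pow, hax, Complex.norm_real, Real.norm_eq_abs, sq_abs, mul_pow,
    Real.sq_sqrt hr₀, mul_one]

theorem inner_erVector_zero (e : OrthonormalBasis (Fin m) ℂ H) (hm : 2 ≤ m) {r₀ r₁ : ℝ} (t : ℝ)
    (j : Fin m) :
    inner ℂ (erVector e t 0) (pyramidVector e r₀ r₁ j) = ((√(1 - t ^ 2) * √r₀ : ℝ) : ℂ) := by
  have h0 : (0 : ℝ) < m := by positivity
  have hs : √(m : ℝ) ≠ 0 := by positivity
  simp only [erVector, Fin.cons_zero, pyramidVector, inner_add_right, inner_smul_left,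
    inner_smul_right, inner_axis_basis, inner_axis_axis e hm, Complex.conj_ofReal]
  have : √((m : ℝ) * r₁) * (√(1 - t ^ 2) * (1 / √m)) + (√r₀ - √r₁) * (√(1 - t ^ 2) * 1) =
      √(1 - t ^ 2) * √r₀ := by
    rw [Real.sqrt_mul h0.le]; field_simp; ring
  exact_mod_cast this

theorem inner_erVector_succ (e : OrthonormalBasis (Fin m) ℂ H) (hm : 2 ≤ m) {r₀ r₁ : ℝ} (t : ℝ)
    (l j : Fin m) :
    inner ℂ (erVector e t l.succ) (pyramidVector e r₀ r₁ j) =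
      (((if j = l then √(m * r₁) else 0) + (t * √r₀ - √r₁) / √m : ℝ) : ℂ) := by
  have h0 : (0 : ℝ) < m := by positivity
  have hs : √(m : ℝ) ≠ 0 := by positivity
  simp only [erVector, Fin.cons_succ, pyramidVector, inner_add_left, inner_add_right,
    inner_smul_left, inner_smul_right, inner_axis_basis, inner_basis_axis, inner_axis_axis e hm,
    Complex.conj_ofReal, e.inner_eq_ite, eq_comm (a := l)]
  have key : (t - 1) / √m * (√((m : ℝ) * r₁) * (1 / √m)) + (√r₀ - √r₁) * (1 / √m) +
      (t - 1) / √m * (√r₀ - √r₁) = (t * √r₀ - √r₁) / √m := by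
    rw [Real.sqrt_mul h0.le]; field_simp; ring
  have key' := congrArg (fun x : ℝ => (x : ℂ)) key
  push_cast at key' ⊢
  split_ifs <;> push_cast <;> linear_combination key'

theorem inner_rankOne_self_re (φ ψ : H) {x : ℝ} (h : inner ℂ φ ψ = (x : ℂ)) :
    (inner ℂ ψ (InnerProductSpace.rankOne ℂ φ φ ψ)).re = x ^ 2 := by
  rw [InnerProductSpace.rankOne_apply, inner_smul_right, ← inner_conj_symm ψ φ, h,
    Complex.conj_ofReal, ← Complex.ofReal_mul, Complex.ofReal_re, sq]

theorem norm_pyramidVector (e : OrthonormalBasis (Fin m) ℂ H) (hm : 2 ≤ m) {r₀ r₁ : ℝ}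
    (hr₀ : 0 ≤ r₀) (hr₁ : 0 ≤ r₁) (hr : r₀ + ((m : ℝ) - 1) * r₁ = 1) (j : Fin m) :
    ‖pyramidVector e r₀ r₁ j‖ ^ 2 = 1 := by
  rw [← inner_self_eq_norm_sq (𝕜 := ℂ), inner_pyramidVector_self e hm hr₀ hr₁ hr j]
  rfl

variable [FiniteDimensional ℂ H]

theorem trace_rankOne_comp_re (ψ : H) (M : H →L[ℂ] H) :
    (LinearMap.trace ℂ H (InnerProductSpace.rankOne ℂ ψ ψ ∘L M).toLinearMap).re =
      (inner ℂ ψ (M ψ)).re := by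
  rw [InnerProductSpace.rankOne_comp, InnerProductSpace.trace_rankOne,
    ContinuousLinearMap.adjoint_inner_left]

theorem jointProb_pyramidEnsemble (e : OrthonormalBasis (Fin m) ℂ H) (hm : 2 ≤ m) {r₀ r₁ : ℝ}
    (hr₀ : 0 ≤ r₀) (hr₁ : 0 ≤ r₁) (hr : r₀ + ((m : ℝ) - 1) * r₁ = 1) (M : QObservable H k)
    (j : Fin m) (l : Fin k) :
    jointProb (pyramidEnsemble e hm hr₀ hr₁ hr) M j l =
      (inner ℂ (pyramidVector e r₀ r₁ j) (M.effect l (pyramidVector e r₀ r₁ j))).re / m := by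
  simp only [jointProb, pyramidEnsemble, trace_rankOne_comp_re]
  ring

theorem mutualInformation_mul_log (e : OrthonormalBasis (Fin m) ℂ H) (hm : 2 ≤ m) {r₀ r₁ : ℝ}
    (hr₀ : 0 ≤ r₀) (hr₁ : 0 ≤ r₁) (hr : r₀ + ((m : ℝ) - 1) * r₁ = 1) (M : QObservable H k)
    (v : Fin m → Fin k → ℝ)
    (hv : ∀ j l, (inner ℂ (pyramidVector e r₀ r₁ j)
      (M.effect l (pyramidVector e r₀ r₁ j))).re = v j l) :
    mutualInformation (pyramidEnsemble e hm hr₀ hr₁ hr) M * Real.log 2 =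
      (∑ l, ∑ j, v j l * Real.log (m * (v j l / ∑ i, v i l))) / m := by
  have h0 : (m : ℝ) ≠ 0 := by positivity
  have hlog : Real.log 2 ≠ 0 := (Real.log_pos one_lt_two).ne'
  have hp : ∀ j, (pyramidEnsemble e hm hr₀ hr₁ hr).prob j = 1 / m := fun _ => rfl
  simp only [mutualInformation, outputProb, jointProb_pyramidEnsemble, hv, hp, Real.logb]
  rw [Finset.sum_comm, Finset.sum_mul, Finset.sum_div]
  refine Finset.sum_congr rfl fun l _ => ?_
  rw [Finset.sum_mul, Finset.sum_div]
  refine Finset.sum_congr rfl fun j _ => ?_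
  rw [← Finset.sum_div]
  have : v j l / m / (1 / m * ((∑ i, v i l) / m)) = m * (v j l / ∑ i, v i l) := by
    rcases eq_or_ne (∑ i, v i l) 0 with h | h
    · simp [h]
    · field_simp
  rw [this]
  field_simp

/-- A positive operator is of the form `x ↦ B† B x`. -/
theorem exists_inner_eq_norm_sq {M : H →L[ℂ] H} (hM : M.IsPositive) :
    ∃ B : H →L[ℂ] H, ∀ x, (inner ℂ x (M x)).re = ‖B x‖ ^ 2 := by
  have : CompleteSpace H := FiniteDimensional.complete ℂ H
  obtain ⟨B, rfl⟩ := CStarAlgebra.nonneg_iff_eq_star_mul_self.1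
    ((ContinuousLinearMap.nonneg_iff_isPositive M).2 hM)
  refine ⟨B, fun x => ?_⟩
  change (inner ℂ x (star B (B x))).re = _
  rw [ContinuousLinearMap.star_eq_adjoint, ContinuousLinearMap.adjoint_inner_right]
  exact inner_self_eq_norm_sq (𝕜 := ℂ) (B x)

theorem sum_inner_effect (M : QObservable H k) (x : H) :
    ∑ l, (inner ℂ x (M.effect l x)).re = ‖x‖ ^ 2 := by
  have h := congrArg (fun T : H →L[ℂ] H => (inner ℂ x (T x)).re) M.effect_sum
  simp only [sum_apply, inner_sum, Complex.re_sum,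
    ContinuousLinearMap.id_apply] at h
  rw [h]
  exact inner_self_eq_norm_sq (𝕜 := ℂ) x

/-- Upper bound for the information gained by any observable about a pyramid. -/
theorem mutualInformation_mul_log_le (e : OrthonormalBasis (Fin m) ℂ H) (hm : 2 ≤ m)
    {r₀ r₁ w : ℝ} (hr₀ : 0 ≤ r₀) (hr₁ : 0 ≤ r₁) (hr : r₀ + ((m : ℝ) - 1) * r₁ = 1)
    (h0 : 0 ≤ w) (h1 : w < 1) (hw : ((m : ℝ) - 1) * w ≤ 1) (M : QObservable H k) :
    mutualInformation (pyramidEnsemble e hm hr₀ hr₁ hr) M * Real.log 2 ≤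
      Real.log m + twoLevelNegEntropy (m - 1) w +
        twoLevelMultiplier (m - 1) w * (twoLevelOverlap (m - 1) w - m * r₀) := by
  have hm2 : (2 : ℝ) ≤ m := by exact_mod_cast hm
  have hm0 : (0 : ℝ) < m := by linarith
  choose B hB using fun l => exists_inner_eq_norm_sq (M.effect_pos l)
  set ψ := pyramidVector e r₀ r₁ with hψ
  rw [mutualInformation_mul_log e hm hr₀ hr₁ hr M (fun j l => ‖B l (ψ j)‖ ^ 2)
    (fun j l => hB l (ψ j)), div_le_iff₀ hm0]
  have hc := twoLevelMultiplier_nonneg (n := (m : ℝ) - 1) (by linarith) h0 h1.le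
  set c := twoLevelMultiplier ((m : ℝ) - 1) w
  set d := twoLevelNegEntropy ((m : ℝ) - 1) w + c * twoLevelOverlap ((m : ℝ) - 1) w with hd
  have hterm : ∀ l, ∑ j, ‖B l (ψ j)‖ ^ 2 *
        Real.log (m * (‖B l (ψ j)‖ ^ 2 / ∑ i, ‖B l (ψ i)‖ ^ 2)) ≤
      (Real.log m + d) * ∑ j, ‖B l (ψ j)‖ ^ 2 - c * ‖B l (∑ j, ψ j)‖ ^ 2 := by
    intro l
    have hmain := sum_mul_log_div_le (ι := Fin m) (n := (m : ℝ) - 1) (by simp) (by linarith) h0 h1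
      hw (fun j => ‖B l (ψ j)‖ ^ 2) (fun j => sq_nonneg _)
    simp only [Real.sqrt_sq (norm_nonneg _)] at hmain
    -- The overlap of a single outcome is not fixed, but it dominates a quantity that is quadratic
    -- in `B l`, hence linear in the effect, whose sum over outcomes is known.
    have htri : ‖B l (∑ j, ψ j)‖ ^ 2 ≤ (∑ j, ‖B l (ψ j)‖) ^ 2 := by
      rw [map_sum]
      exact pow_le_pow_left₀ (norm_nonneg _) (norm_sum_le _ _) 2
    have hsplit : ∑ j, ‖B l (ψ j)‖ ^ 2 *
          Real.log (m * (‖B l (ψ j)‖ ^ 2 / ∑ i, ‖B l (ψ i)‖ ^ 2)) =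
        Real.log m * ∑ j, ‖B l (ψ j)‖ ^ 2 + ∑ j, ‖B l (ψ j)‖ ^ 2 *
          Real.log (‖B l (ψ j)‖ ^ 2 / ∑ i, ‖B l (ψ i)‖ ^ 2) := by
      rw [Finset.mul_sum, ← Finset.sum_add_distrib]
      refine Finset.sum_congr rfl fun j _ => ?_
      rcases (sq_nonneg ‖B l (ψ j)‖).eq_or_lt with h | h
      · rw [← h]; simp
      · have hV : 0 < ∑ i, ‖B l (ψ i)‖ ^ 2 :=
          h.trans_le (Finset.single_le_sum (f := fun i => ‖B l (ψ i)‖ ^ 2)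
            (fun i _ => sq_nonneg _) (Finset.mem_univ j))
        rw [Real.log_mul hm0.ne' (div_pos h hV).ne']; ring
    rw [hsplit]
    have := mul_le_mul_of_nonneg_left htri hc
    linarith
  refine (Finset.sum_le_sum fun l _ => hterm l).trans (le_of_eq ?_)
  have s1 : ∑ l, ∑ j, ‖B l (ψ j)‖ ^ 2 = m := by
    rw [Finset.sum_comm]
    simp only [← hB, sum_inner_effect, hψ, norm_pyramidVector e hm hr₀ hr₁ hr]
    simp
  have s2 : ∑ l, ‖B l (∑ j, ψ j)‖ ^ 2 = (m : ℝ) ^ 2 * r₀ := by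
    simp only [← hB, sum_inner_effect, hψ, norm_sum_pyramidVector e hm hr₀]
  rw [Finset.sum_sub_distrib, ← Finset.mul_sum, ← Finset.mul_sum, s1, s2, hd]
  ring

/-- The information gained by the Englert–Řeháček observable. -/
theorem mutualInformation_erObservable (e : OrthonormalBasis (Fin m) ℂ H) (hm : 2 ≤ m)
    {r₀ r₁ t x y : ℝ} (hr₀ : 0 ≤ r₀) (hr₁ : 0 ≤ r₁) (hr : r₀ + ((m : ℝ) - 1) * r₁ = 1)
    (ht : t ∈ Set.Icc (0 : ℝ) 1) (hy : y = (t * √r₀ - √r₁) / √m) (hx : x = √(m * r₁) + y) :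
    mutualInformation (pyramidEnsemble e hm hr₀ hr₁ hr) (erObservable e hm ht) * Real.log 2 =
      x ^ 2 * Real.log (m * (x ^ 2 / (x ^ 2 + (m - 1) * y ^ 2))) +
        (m - 1) * (y ^ 2 * Real.log (m * (y ^ 2 / (x ^ 2 + (m - 1) * y ^ 2)))) := by
  have hm0 : (m : ℝ) ≠ 0 := by positivity
  rw [mutualInformation_mul_log e hm hr₀ hr₁ hr _
    (fun j => Fin.cons ((√(1 - t ^ 2) * √r₀) ^ 2) fun l => (if j = l then x else y) ^ 2)]
  · have hsum : ∀ (f : ℝ → ℝ) (l : Fin m),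
        ∑ j, f (if j = l then x else y) = f x + (m - 1) * f y := by
      intro f l
      rw [← Finset.add_sum_erase _ _ (Finset.mem_univ l), if_pos rfl,
        Finset.sum_congr rfl (g := fun _ => f y)
          (fun j hj => by rw [if_neg (Finset.ne_of_mem_erase hj)]),
        Finset.sum_const, Finset.card_erase_of_mem (Finset.mem_univ l), Finset.card_univ,
        Fintype.card_fin, nsmul_eq_mul, Nat.cast_sub (by omega), Nat.cast_one]
    rw [Fin.sum_univ_succ]
    simp only [Fin.cons_zero, Fin.cons_succ]
    -- Outcome `0` has the same probability for every input and so carries no information.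
    have hz : ∀ z : ℝ, z * Real.log (m * (z / ∑ _i : Fin m, z)) = 0 := by
      intro z
      rcases eq_or_ne z 0 with h | h
      · simp [h]
      · have : (m : ℝ) * (z / ∑ _i : Fin m, z) = 1 := by simp; field_simp
        rw [this]; simp
    simp only [hz, Finset.sum_const_zero, zero_add, hsum (fun z => z ^ 2)]
    simp only [hsum (fun z => z ^ 2 * Real.log (m * (z ^ 2 / (x ^ 2 + (m - 1) * y ^ 2))))]
    simp
    field_simp
  · intro j l
    refine Fin.cases ?_ (fun l => ?_) l
    · exact inner_rankOne_self_re _ _ (inner_erVector_zero e hm t j)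
    · refine inner_rankOne_self_re _ _ ((inner_erVector_succ e hm t l j).trans ?_)
      rw [← hy]
      congr 1
      split_ifs
      · exact hx.symm
      · ring

theorem IsInformationOptimal.accessibleInformation_eq {E : QEnsemble H m} {M : QObservable H k}
    (h : IsInformationOptimal E M) : accessibleInformation E = mutualInformation E M :=
  IsGreatest.csSup_eq ⟨⟨k, M, rfl⟩, by rintro x ⟨n, N, rfl⟩; exact h n N⟩

/-- All edges coincide when `r₁ = 0`. The case is needed because the Lagrangian bound excludes `w =
1`. -/
theorem mutualInformation_eq_zero_of_degenerate (e : OrthonormalBasis (Fin m) ℂ H) (hm : 2 ≤ m)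
    {r₀ : ℝ} (hr₀ : 0 ≤ r₀) (hr : r₀ + ((m : ℝ) - 1) * 0 = 1) (M : QObservable H k) :
    mutualInformation (pyramidEnsemble e hm hr₀ le_rfl hr) M = 0 := by
  have hm0 : (m : ℝ) ≠ 0 := by positivity
  have hψ : ∀ j, pyramidVector e r₀ 0 j = ((√r₀ : ℝ) : ℂ) • pyramidAxis e := fun j => by
    simp [pyramidVector]
  have h := mutualInformation_mul_log e hm hr₀ le_rfl hr M
    (fun _ l => (inner ℂ (((√r₀ : ℝ) : ℂ) • pyramidAxis e)
      (M.effect l (((√r₀ : ℝ) : ℂ) • pyramidAxis e))).re) (fun j l => by rw [hψ])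
  refine (mul_eq_zero_iff_right (Real.log_pos one_lt_two).ne').1 (h.trans ?_)
  rw [div_eq_zero_iff]
  refine Or.inl (Finset.sum_eq_zero fun l _ => Finset.sum_eq_zero fun j _ => ?_)
  set z := (inner ℂ (((√r₀ : ℝ) : ℂ) • pyramidAxis e)
      (M.effect l (((√r₀ : ℝ) : ℂ) • pyramidAxis e))).re
  rcases eq_or_ne z 0 with h | h
  · simp [h]
  · have : (m : ℝ) * (z / ∑ _i : Fin m, z) = 1 := by simp; field_simp
    rw [this]; simp

end Quantum

/-! ### The coefficients of the pyramid and the threshold -/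

theorem twoLevelNegEntropy_div {n a b : ℝ} (ha : 0 < a) (hb : 0 ≤ b)
    (h : a ^ 2 + n * b ^ 2 = 1) : twoLevelNegEntropy n (b / a) =
      a ^ 2 * Real.log (a ^ 2) + n * (b ^ 2 * Real.log (b ^ 2)) := by
  have e1 : 1 + n * (b / a) ^ 2 = (a ^ 2)⁻¹ := by field_simp; linarith
  have e2 : b ^ 2 * Real.log (b / a) = b ^ 2 * Real.log b - b ^ 2 * Real.log a := by
    rcases hb.eq_or_lt with h | h
    · rw [← h]; simp
    · rw [Real.log_div h.ne' ha.ne']; ring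
  rw [twoLevelNegEntropy, e1, Real.log_inv, Real.log_pow, Real.log_pow]
  have e3 : 2 * n * (b / a) * (b / a * Real.log (b / a)) / (a ^ 2)⁻¹ =
      2 * n * (b ^ 2 * Real.log (b / a)) := by field_simp
  rw [e3, e2]
  push_cast
  linear_combination -2 * Real.log a * h

theorem twoLevelOverlap_div {n a b : ℝ} (ha : 0 < a) (h : a ^ 2 + n * b ^ 2 = 1) :
    twoLevelOverlap n (b / a) = (a + n * b) ^ 2 := by
  have e1 : 1 + n * (b / a) ^ 2 = (a ^ 2)⁻¹ := by field_simp; linarith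
  rw [twoLevelOverlap, e1]; field_simp

/-- The inner products `a = ⟨e_j, ψ_j⟩` and `b = ⟨e_i, ψ_j⟩`, `i ≠ j`, of the pyramid. -/
structure PyramidCoefficients (m : ℕ) (r₀ r₁ a b : ℝ) : Prop where
  sq_add : a ^ 2 + ((m : ℝ) - 1) * b ^ 2 = 1
  add_sq : (a + ((m : ℝ) - 1) * b) ^ 2 = m * r₀
  sub_eq : a = √(m * r₁) + b
  b_eq : b = (√r₀ - √r₁) / √m
  b_nonneg : 0 ≤ b
  le : b ≤ a
  a_pos : 0 < a

theorem pyramidCoefficients {m : ℕ} (hm : 2 ≤ m) {r₀ r₁ : ℝ}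
    (hr₀ : 0 ≤ r₀) (hr₁ : 0 ≤ r₁) (hr : r₀ + ((m : ℝ) - 1) * r₁ = 1) (hacute : r₁ ≤ r₀) :
    PyramidCoefficients m r₀ r₁ (√(m * r₁) + (√r₀ - √r₁) / √m) ((√r₀ - √r₁) / √m) := by
  have h0 : (0 : ℝ) < m := by positivity
  have hq : 0 < √(m : ℝ) := by positivity
  have hqq := Real.mul_self_sqrt h0.le
  have e0 := Real.mul_self_sqrt hr₀
  have e1 := Real.mul_self_sqrt hr₁
  have hle : √r₁ ≤ √r₀ := Real.sqrt_le_sqrt hacute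
  have h1 := Real.sqrt_nonneg r₁
  have hb : 0 ≤ (√r₀ - √r₁) / √(m : ℝ) := div_nonneg (by linarith) hq.le
  have hsum : √(m : ℝ) * ((√r₀ - √r₁) / √m) = √r₀ - √r₁ := by field_simp
  have hbq : (m : ℝ) * ((√r₀ - √r₁) / √m) = √m * (√r₀ - √r₁) := by
    nth_rw 1 [← hqq]; rw [mul_assoc, hsum]
  have hmul : √((m : ℝ) * r₁) = √m * √r₁ := Real.sqrt_mul h0.le _
  have hS : √((m : ℝ) * r₁) + (√r₀ - √r₁) / √m + ((m : ℝ) - 1) * ((√r₀ - √r₁) / √m) =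
      √m * √r₀ := by rw [hmul]; linear_combination hbq
  refine ⟨?_, ?_, rfl, rfl, hb, by linarith [Real.sqrt_nonneg ((m : ℝ) * r₁)], ?_⟩
  · rw [hmul]
    set b := (√r₀ - √r₁) / √(m : ℝ)
    have hbb : (m : ℝ) * b ^ 2 = (√r₀ - √r₁) ^ 2 := by
      rw [← hsum]; linear_combination -b ^ 2 * hqq
    linear_combination hbb + 2 * √r₁ * hsum + √r₁ ^ 2 * hqq + e0 + (m - 1) * e1 + hr
  · rw [hS, mul_pow, Real.sq_sqrt h0.le, Real.sq_sqrt hr₀]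
  · by_contra hcon
    have hz := Real.sqrt_nonneg ((m : ℝ) * r₁)
    have hb0 : (√r₀ - √r₁) / √(m : ℝ) = 0 := by linarith
    have hm0 : √((m : ℝ) * r₁) = 0 := by linarith
    rw [hm0, hb0] at hS
    have h2 : √r₀ = 0 := by
      have : √(m : ℝ) * √r₀ = 0 := by linarith
      exact (mul_eq_zero.1 this).resolve_left hq.ne'
    have h3 : √r₁ = 0 := by linarith
    rw [h2] at e0; rw [h3] at e1
    rw [← e0, ← e1] at hr
    norm_num at hr

namespace PyramidCoefficients

variable {m : ℕ} {r₀ r₁ a b : ℝ}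

theorem sq_sub (h : PyramidCoefficients m r₀ r₁ a b) (hr₁ : 0 ≤ r₁) :
    (a - b) ^ 2 = m * r₁ := by
  rw [h.sub_eq, add_sub_cancel_right, Real.sq_sqrt (by positivity)]

theorem pyramidP_eq (h : PyramidCoefficients m r₀ r₁ a b) : pyramidP m r₀ r₁ = a ^ 2 := by
  rw [h.sub_eq, h.b_eq, pyramidP]

/-- Homogenizing with `1 = a² + (m - 1) b²` turns the difference into a quadratic form in `a, b`,
which factors. The second factor is nonnegative, so the threshold on `r₀` amounts to the sign of `a
- (m - 1) b`. -/
theorem threshold_sub (h : PyramidCoefficients m r₀ r₁ a b) (hm : 2 ≤ m) :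
    4 * ((m : ℝ) - 1) / (m : ℝ) ^ 2 - r₀ =
      (a - (m - 1) * b) * ((3 * m - 4) * (a - b) + m * (m - 2) * b) / m ^ 2 := by
  have h0 : (m : ℝ) ≠ 0 := by positivity
  have e : r₀ = m * (a + ((m : ℝ) - 1) * b) ^ 2 / m ^ 2 := by rw [h.add_sq]; field_simp
  rw [e, ← sub_div]
  congr 1
  linear_combination -4 * ((m : ℝ) - 1) * h.sq_add

theorem second_factor_nonneg (h : PyramidCoefficients m r₀ r₁ a b) (hm : 2 ≤ m) :
    0 ≤ (3 * (m : ℝ) - 4) * (a - b) + m * (m - 2) * b := by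
  have hm2 : (2 : ℝ) ≤ m := by exact_mod_cast hm
  have := h.b_nonneg
  have := h.le
  have h1 : 0 ≤ (3 * (m : ℝ) - 4) * (a - b) := mul_nonneg (by linarith) (by linarith)
  have h2 : 0 ≤ (m : ℝ) * (m - 2) * b :=
    mul_nonneg (mul_nonneg (by linarith) (by linarith)) (by linarith)
  linarith

theorem le_threshold (h : PyramidCoefficients m r₀ r₁ a b) (hm : 2 ≤ m)
    (hab : ((m : ℝ) - 1) * b ≤ a) : r₀ ≤ 4 * ((m : ℝ) - 1) / (m : ℝ) ^ 2 := by
  have := h.threshold_sub hm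
  have h2 := div_nonneg (mul_nonneg (sub_nonneg.2 hab) (h.second_factor_nonneg hm))
    (sq_nonneg (m : ℝ))
  linarith

theorem mul_le_of_le_threshold (h : PyramidCoefficients m r₀ r₁ a b) (hm : 2 ≤ m)
    (hr : r₀ ≤ 4 * ((m : ℝ) - 1) / (m : ℝ) ^ 2) : ((m : ℝ) - 1) * b ≤ a := by
  have hm2 : (2 : ℝ) ≤ m := by exact_mod_cast hm
  by_contra hcon
  push Not at hcon
  have hid := h.threshold_sub hm
  have hb := h.b_nonneg
  have ha := h.a_pos
  have hm3 : 2 < (m : ℝ) := by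
    by_contra h2
    have : (m : ℝ) = 2 := by linarith
    rw [this] at hcon; linarith [h.le]
  have hb1 : 0 < b := by
    rcases hb.eq_or_lt with h' | h'
    · rw [← h'] at hcon; linarith
    · exact h'
  have h2 : 0 < (3 * (m : ℝ) - 4) * (a - b) + m * (m - 2) * b := by
    have h1 : 0 ≤ (3 * (m : ℝ) - 4) * (a - b) := mul_nonneg (by linarith) (by linarith [h.le])
    have h2 : 0 < (m : ℝ) * (m - 2) * b :=
      mul_pos (mul_pos (by linarith) (by linarith)) hb1
    linarith
  have h3 := div_neg_of_neg_of_pos (mul_neg_of_neg_of_pos (sub_neg.2 hcon) h2)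
    (show 0 < (m : ℝ) ^ 2 by positivity)
  linarith

end PyramidCoefficients

/-! ### Matching upper bounds and attained values -/

section Optimality

variable {H : Type*} [NormedAddCommGroup H] [InnerProductSpace ℂ H] [FiniteDimensional ℂ H]
  {m k : ℕ}

theorem mutualInformation_srm (e : OrthonormalBasis (Fin m) ℂ H) (hm : 2 ≤ m) {r₀ r₁ a b : ℝ}
    (hr₀ : 0 ≤ r₀) (hr₁ : 0 ≤ r₁) (hr : r₀ + ((m : ℝ) - 1) * r₁ = 1)
    (hab : PyramidCoefficients m r₀ r₁ a b) {t : ℝ} (ht : t ∈ Set.Icc (0 : ℝ) 1) (ht1 : t = 1) :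
    mutualInformation (pyramidEnsemble e hm hr₀ hr₁ hr) (erObservable e hm ht) * Real.log 2 =
      a ^ 2 * Real.log (m * a ^ 2) + (m - 1) * (b ^ 2 * Real.log (m * b ^ 2)) := by
  rw [mutualInformation_erObservable e hm hr₀ hr₁ hr ht (x := a) (y := b)
    (by rw [hab.b_eq, ht1, one_mul]) hab.sub_eq, hab.sq_add, div_one, div_one]

theorem mutualInformation_le_srm (e : OrthonormalBasis (Fin m) ℂ H) (hm : 2 ≤ m) {r₀ r₁ a b : ℝ}
    (hr₀ : 0 ≤ r₀) (hr₁ : 0 ≤ r₁) (hr : r₀ + ((m : ℝ) - 1) * r₁ = 1)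
    (hab : PyramidCoefficients m r₀ r₁ a b) (hle : ((m : ℝ) - 1) * b ≤ a) (M : QObservable H k) :
    mutualInformation (pyramidEnsemble e hm hr₀ hr₁ hr) M * Real.log 2 ≤
      a ^ 2 * Real.log (m * a ^ 2) + (m - 1) * (b ^ 2 * Real.log (m * b ^ 2)) := by
  have hm2 : (2 : ℝ) ≤ m := by exact_mod_cast hm
  have hm0 : (0 : ℝ) < m := by linarith
  have ha := hab.a_pos
  have hsq := hab.sq_add
  -- `a = b` would mean `w = 1`, where the multiplier is `0/0`. Under `(m - 1) b ≤ a` it occurs only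
  -- for `m = 2`, `r₁ = 0`.
  rcases hab.le.eq_or_lt with heq | hlt
  · have hm1 : (m : ℝ) = 2 := by
      rw [heq] at hle
      have : (m : ℝ) - 1 ≤ 1 := by
        by_contra h
        nlinarith
      linarith
    have hr1 : r₁ = 0 := by
      have := hab.sq_sub hr₁
      rw [heq, sub_self, zero_pow two_ne_zero] at this
      exact (mul_eq_zero.1 this.symm).resolve_left hm0.ne'
    subst hr1
    rw [mutualInformation_eq_zero_of_degenerate e hm hr₀ hr M, zero_mul]
    have : (m : ℝ) * a ^ 2 = 1 := by rw [← hsq, heq]; ring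
    rw [heq, this]; simp
  -- With `w = b / a` the overlap is exactly `m r₀`, so the multiplier term drops out.
  · have h := mutualInformation_mul_log_le e hm hr₀ hr₁ hr (div_nonneg hab.b_nonneg ha.le)
      ((div_lt_one ha).2 hlt) (by rw [← mul_div_assoc, div_le_one ha]; exact hle) M
    rw [twoLevelOverlap_div ha hsq, hab.add_sq, sub_self, mul_zero, add_zero,
      twoLevelNegEntropy_div ha hab.b_nonneg hsq] at h
    refine h.trans (le_of_eq ?_)
    have hlb : b ^ 2 * Real.log (m * b ^ 2) = b ^ 2 * Real.log m + b ^ 2 * Real.log (b ^ 2) := by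
      rcases hab.b_nonneg.eq_or_lt with h' | h'
      · rw [← h']; simp
      · rw [Real.log_mul hm0.ne' (by positivity)]; ring
    rw [Real.log_mul hm0.ne' (by positivity), hlb]
    linear_combination -Real.log m * hsq

/-- The Lagrangian bound at `w = 1/(m - 1)`, whose multiplier is `log (m - 1) / (m - 2)`; the result
is affine in `r₀` and vanishes at `r₀ = 1`. -/
theorem mutualInformation_le_of_three_le (e : OrthonormalBasis (Fin m) ℂ H) (hm : 2 ≤ m)
    (hm3 : 3 ≤ m) {r₀ r₁ : ℝ} (hr₀ : 0 ≤ r₀) (hr₁ : 0 ≤ r₁)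
    (hr : r₀ + ((m : ℝ) - 1) * r₁ = 1) (M : QObservable H k) :
    mutualInformation (pyramidEnsemble e hm hr₀ hr₁ hr) M * Real.log 2 ≤
      (m : ℝ) * (1 - r₀) / ((m : ℝ) - 2) * Real.log ((m : ℝ) - 1) := by
  have hm2 : (3 : ℝ) ≤ m := by exact_mod_cast hm3
  have hm0 : (0 : ℝ) < m := by linarith
  have hn : 0 < (m : ℝ) - 1 := by linarith
  have hn2 : (m : ℝ) - 2 ≠ 0 := by linarith
  have h := mutualInformation_mul_log_le e hm hr₀ hr₁ hr (w := ((m : ℝ) - 1)⁻¹) (by positivity)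
    (inv_lt_one_of_one_lt₀ (by linarith)) (mul_inv_cancel₀ hn.ne').le M
  refine h.trans (le_of_eq ?_)
  have e1 : 1 + ((m : ℝ) - 1) * ((m : ℝ) - 1)⁻¹ ^ 2 = m / (m - 1) := by field_simp; ring
  have e2 : ((m : ℝ) - 1) * ((m : ℝ) - 1)⁻¹ = 1 := mul_inv_cancel₀ hn.ne'
  have e3 : (m : ℝ) - 1 - 1 = m - 2 := by ring
  rw [twoLevelMultiplier_inv (by linarith), twoLevelNegEntropy, twoLevelOverlap, e1, e2,
    Real.log_div hm0.ne' hn.ne', Real.log_inv, e3]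
  field_simp
  ring

theorem mutualInformation_erObservable_of_ratio (e : OrthonormalBasis (Fin m) ℂ H) (hm : 2 ≤ m)
    (hm3 : 3 ≤ m) {r₀ r₁ t : ℝ} (hr₀ : 0 ≤ r₀) (hr₁ : 0 ≤ r₁)
    (hr : r₀ + ((m : ℝ) - 1) * r₁ = 1) (ht : t ∈ Set.Icc (0 : ℝ) 1)
    (htr : t * √r₀ = 2 * ((m : ℝ) - 1) / ((m : ℝ) - 2) * √r₁) :
    mutualInformation (pyramidEnsemble e hm hr₀ hr₁ hr) (erObservable e hm ht) * Real.log 2 =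
      (m : ℝ) * (1 - r₀) / ((m : ℝ) - 2) * Real.log ((m : ℝ) - 1) := by
  have hm2 : (3 : ℝ) ≤ m := by exact_mod_cast hm3
  have hm0 : (0 : ℝ) < m := by linarith
  have hn : 0 < (m : ℝ) - 1 := by linarith
  have hn2 : (m : ℝ) - 2 ≠ 0 := by linarith
  have hq : 0 < √(m : ℝ) := by positivity
  have hqq := Real.mul_self_sqrt hm0.le
  -- The condition on `t` is the one giving amplitudes `(m - 1) y` and `y`, that is, the ratio `1/(m
  -- - 1)` at which the upper bound was taken.
  set y := √((m : ℝ) * r₁) / (m - 2) with hy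
  rw [mutualInformation_erObservable e hm hr₀ hr₁ hr ht (y := y) (x := (m - 1) * y)]
  · have hyy : ((m : ℝ) - 2) ^ 2 * y ^ 2 = m * r₁ := by
      rw [← mul_pow, hy, mul_div_cancel₀ _ hn2, Real.sq_sqrt (by positivity)]
    have hr' : m * (1 - r₀) = (m - 1) * (((m : ℝ) - 2) ^ 2 * y ^ 2) := by
      rw [hyy]; linear_combination -(m : ℝ) * hr
    rw [hr']
    rcases eq_or_ne y 0 with h | h
    · simp [h]
    have e1 : (m : ℝ) * (((m - 1) * y) ^ 2 / (((m - 1) * y) ^ 2 + (m - 1) * y ^ 2)) = m - 1 := by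
      have : ((m - 1) * y) ^ 2 + (m - 1) * y ^ 2 = m * (m - 1) * y ^ 2 := by ring
      rw [this]; field_simp
    have e2 : (m : ℝ) * (y ^ 2 / (((m - 1) * y) ^ 2 + (m - 1) * y ^ 2)) = ((m : ℝ) - 1)⁻¹ := by
      have : ((m - 1) * y) ^ 2 + (m - 1) * y ^ 2 = m * (m - 1) * y ^ 2 := by ring
      rw [this]; field_simp
    rw [e1, e2, Real.log_inv]
    field_simp
    ring
  · rw [htr, hy, Real.sqrt_mul hm0.le]
    field_simp
    linear_combination √r₁ * hqq
  · rw [hy]; field_simp; ring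

theorem IsInformationOptimal.of_mul_log_le {E : QEnsemble H m} {M : QObservable H k} {v : ℝ}
    (hM : mutualInformation E M * Real.log 2 = v)
    (h : ∀ (n : ℕ) (N : QObservable H n), mutualInformation E N * Real.log 2 ≤ v) :
    IsInformationOptimal E M := fun n N =>
  le_of_mul_le_mul_right ((h n N).trans hM.ge) (Real.log_pos one_lt_two)

end Optimality

/-! ### Admissibility of the parameter and the final formulas -/

theorem optimalParameter_mem_Icc {m : ℕ} (hm : 2 ≤ m) {r₀ r₁ : ℝ} (hr₁ : 0 ≤ r₁)
    (hr : r₀ + ((m : ℝ) - 1) * r₁ = 1) : optimalParameter m r₀ r₁ ∈ Set.Icc (0 : ℝ) 1 := by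
  have hm2 : (2 : ℝ) ≤ m := by exact_mod_cast hm
  unfold optimalParameter
  split_ifs with h
  · simp
  · push Not at h
    have hr0 : 0 < r₀ := lt_of_le_of_lt (by apply div_nonneg <;> nlinarith) h
    rw [div_lt_iff₀ (by positivity)] at h
    have hm3 : 2 < (m : ℝ) := by
      by_contra h2
      have : (m : ℝ) = 2 := by linarith
      rw [this] at h hr; linarith
    refine ⟨mul_nonneg (div_nonneg (by linarith) (by linarith)) (Real.sqrt_nonneg _), ?_⟩
    -- Using `(m - 1) r₁ = 1 - r₀` and `(m - 2)² + 4 (m - 1) = m²`, this is the inequality `4 (m -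
    -- 1) ≤ m² r₀`.
    have hle : r₁ / r₀ ≤ ((m - 2) / (2 * (m - 1))) ^ 2 := by
      have h1 : (m : ℝ) - 1 ≠ 0 := by linarith
      rw [div_pow, div_le_div_iff₀ hr0 (pow_pos (by linarith) 2)]
      have : r₁ * (2 * ((m : ℝ) - 1)) ^ 2 = 4 * (m - 1) * (1 - r₀) := by
        linear_combination 4 * ((m : ℝ) - 1) * hr
      rw [this]; nlinarith
    have hs : √(r₁ / r₀) ≤ (m - 2) / (2 * (m - 1)) :=
      (Real.sqrt_le_sqrt hle).trans_eq
        (Real.sqrt_sq (div_nonneg (by linarith) (by linarith)))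
    calc 2 * ((m : ℝ) - 1) / (m - 2) * √(r₁ / r₀)
        ≤ 2 * ((m : ℝ) - 1) / (m - 2) * ((m - 2) / (2 * (m - 1))) :=
          mul_le_mul_of_nonneg_left hs (div_nonneg (by linarith) (by linarith))
      _ = 1 := by
          have h1 : (m : ℝ) - 1 ≠ 0 := by linarith
          have h2 : (m : ℝ) - 2 ≠ 0 := by linarith
          field_simp

theorem srmInformation_mul_log {m : ℕ} (hm : 2 ≤ m) {r₀ r₁ a b : ℝ}
    (hab : PyramidCoefficients m r₀ r₁ a b) :
    srmInformation m r₀ r₁ * Real.log 2 =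
      a ^ 2 * Real.log (m * a ^ 2) + (m - 1) * (b ^ 2 * Real.log (m * b ^ 2)) := by
  have h0 : (0 : ℝ) < m := by positivity
  have hlog : Real.log 2 ≠ 0 := (Real.log_pos one_lt_two).ne'
  have hqq := Real.mul_self_sqrt h0.le
  have hq : 0 < √(m : ℝ) := by positivity
  have hb : √r₀ - √r₁ = √m * b := by rw [hab.b_eq]; field_simp
  have ha : √r₀ + ((m : ℝ) - 1) * √r₁ = √m * a := by
    rw [hab.sub_eq, mul_add, ← hb, Real.sqrt_mul h0.le]
    linear_combination -√r₁ * hqq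
  rw [srmInformation, ha, hb, mul_pow, mul_pow, Real.sq_sqrt h0.le]
  simp only [Real.logb]
  field_simp

theorem corollary1 {m : ℕ} (hm : 2 ≤ m)
    {H : Type*} [NormedAddCommGroup H] [InnerProductSpace ℂ H] [FiniteDimensional ℂ H]
    (e : OrthonormalBasis (Fin m) ℂ H) (r₀ r₁ : ℝ)
    (hr₀ : 0 ≤ r₀) (hr₁ : 0 ≤ r₁) (hr : r₀ + ((m : ℝ) - 1) * r₁ = 1) (hacute : r₁ ≤ r₀) :
    -- the observable with parameter `t_a(m)` is information-optimal
    (∃ ht : optimalParameter m r₀ r₁ ∈ Set.Icc (0 : ℝ) 1,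
      IsInformationOptimal (pyramidEnsemble e hm hr₀ hr₁ hr) (erObservable e hm ht) ∧
      accessibleInformation (pyramidEnsemble e hm hr₀ hr₁ hr) =
        mutualInformation (pyramidEnsemble e hm hr₀ hr₁ hr) (erObservable e hm ht)) ∧
    -- the accessible information in terms of the parameter `p`
    pyramidP m r₀ r₁ ∈ Set.Icc (1 / (m : ℝ)) 1 ∧
    (∀ p : ℝ, p = pyramidP m r₀ r₁ →
      (p ∈ Set.Icc (((m : ℝ) - 1) / m) 1 →
        accessibleInformation (pyramidEnsemble e hm hr₀ hr₁ hr) =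
          Real.logb 2 m + p * Real.logb 2 p
            + (1 - p) * Real.logb 2 ((1 - p) / ((m : ℝ) - 1))) ∧
      (3 ≤ m → p ∈ Set.Icc (1 / (m : ℝ)) (((m : ℝ) - 1) / m) →
        accessibleInformation (pyramidEnsemble e hm hr₀ hr₁ hr) =
          ((m : ℝ) - 1) / ((m : ℝ) - 2) * Real.logb 2 ((m : ℝ) - 1)
            * (√p - √((1 - p) / ((m : ℝ) - 1))) ^ 2)) ∧
    -- the conjectured value, in terms of `r₀` and `r₁`
    accessibleInformation (pyramidEnsemble e hm hr₀ hr₁ hr) =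
      (if r₀ ≤ 4 * ((m : ℝ) - 1) / (m : ℝ) ^ 2 then srmInformation m r₀ r₁
       else (m : ℝ) * (1 - r₀) / ((m : ℝ) - 2) * Real.logb 2 ((m : ℝ) - 1)) := by
  have hm2 : (2 : ℝ) ≤ m := by exact_mod_cast hm
  have h0 : (0 : ℝ) < m := by linarith
  have hn : 0 < (m : ℝ) - 1 := by linarith
  have hlog : Real.log 2 ≠ 0 := (Real.log_pos one_lt_two).ne'
  have hab := pyramidCoefficients hm hr₀ hr₁ hr hacute
  have ht := optimalParameter_mem_Icc hm hr₁ hr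
  set a := √((m : ℝ) * r₁) + (√r₀ - √r₁) / √m
  set b := (√r₀ - √r₁) / √(m : ℝ)
  have hsq := hab.sq_add
  have ha := hab.a_pos
  have hb := hab.b_nonneg
  have hba := hab.le
  have hp := hab.pyramidP_eq
  have hopt : IsInformationOptimal (pyramidEnsemble e hm hr₀ hr₁ hr) (erObservable e hm ht) ∧
      mutualInformation (pyramidEnsemble e hm hr₀ hr₁ hr) (erObservable e hm ht) =
      (if r₀ ≤ 4 * ((m : ℝ) - 1) / (m : ℝ) ^ 2 then srmInformation m r₀ r₁
       else (m : ℝ) * (1 - r₀) / ((m : ℝ) - 2) * Real.logb 2 ((m : ℝ) - 1)) := by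
    split_ifs with hc
    · have hs := mutualInformation_srm e hm hr₀ hr₁ hr hab ht (by rw [optimalParameter, if_pos hc])
      refine ⟨.of_mul_log_le hs fun n N => mutualInformation_le_srm e hm hr₀ hr₁ hr hab
        (hab.mul_le_of_le_threshold hm hc) N, ?_⟩
      rw [← srmInformation_mul_log hm hab] at hs
      exact mul_right_cancel₀ hlog hs
    -- For `m = 2` the threshold is `1`, and `r₀ ≤ 1` always holds.
    · have hm3 : 3 ≤ m := by
        by_contra hcon
        have : m = 2 := by omega
        subst this
        apply hc
        norm_num at hr ⊢
        linarith
      have hr0 : 0 < r₀ := by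
        push Not at hc
        exact lt_of_le_of_lt (by positivity) hc
      have hs := mutualInformation_erObservable_of_ratio e hm hm3 hr₀ hr₁ hr ht (by
        rw [optimalParameter, if_neg hc, mul_assoc, ← Real.sqrt_mul (by positivity),
          div_mul_cancel₀ _ hr0.ne'])
      refine ⟨.of_mul_log_le hs fun n N =>
        mutualInformation_le_of_three_le e hm hm3 hr₀ hr₁ hr N, ?_⟩
      rw [Real.logb, ← mul_div_assoc, ← hs, mul_div_cancel_right₀ _ hlog]
  have hval := hopt.1.accessibleInformation_eq.trans hopt.2
  refine ⟨⟨ht, hopt.1, hopt.1.accessibleInformation_eq⟩, ?_, ?_, hval⟩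
  · have hbb : b ^ 2 ≤ a ^ 2 := pow_le_pow_left₀ hb hba 2
    have hnb : 0 ≤ ((m : ℝ) - 1) * b ^ 2 := by positivity
    rw [hp, Set.mem_Icc, div_le_iff₀ h0]
    constructor <;> nlinarith
  · rintro p rfl
    rw [hp, hval]
    have h1p : 1 - a ^ 2 = (m - 1) * b ^ 2 := by linarith
    have h1pn : (1 - a ^ 2) / ((m : ℝ) - 1) = b ^ 2 := by rw [h1p]; field_simp
    have hsrm : srmInformation m r₀ r₁ = Real.logb 2 m + a ^ 2 * Real.logb 2 (a ^ 2)
        + (1 - a ^ 2) * Real.logb 2 ((1 - a ^ 2) / ((m : ℝ) - 1)) := by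
      refine mul_right_cancel₀ hlog ((srmInformation_mul_log hm hab).trans ?_)
      have hlb : b ^ 2 * Real.log (m * b ^ 2) =
          b ^ 2 * Real.log m + b ^ 2 * Real.log (b ^ 2) := by
        rcases hb.eq_or_lt with h' | h'
        · rw [← h']; simp
        · rw [Real.log_mul h0.ne' (by positivity)]; ring
      rw [h1pn, h1p, Real.log_mul h0.ne' (by positivity), hlb]
      simp only [Real.logb]
      field_simp
      linear_combination Real.log m * hsq
    refine ⟨fun hpm => ?_, fun hm3 hpm => ?_⟩
    · have hle : ((m : ℝ) - 1) * b ≤ a := by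
        refine abs_le_of_sq_le_sq' ?_ ha.le |>.2
        have := (div_le_iff₀ h0).1 hpm.1
        nlinarith
      rw [if_pos (hab.le_threshold hm hle), hsrm]
    · have hm3' : (3 : ℝ) ≤ m := by exact_mod_cast hm3
      have hn2 : (m : ℝ) - 2 ≠ 0 := by linarith
      have hge : a ≤ ((m : ℝ) - 1) * b := by
        refine abs_le_of_sq_le_sq' ?_ (by positivity) |>.2
        have := (le_div_iff₀ h0).1 hpm.2
        nlinarith
      rw [h1pn, Real.sqrt_sq ha.le, Real.sqrt_sq hb]
      split_ifs with hc
      -- Only the boundary `p = (m - 1)/m` satisfies both conditions, and there the two formulas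
      -- agree.
      · have heq : a = ((m : ℝ) - 1) * b := le_antisymm hge (hab.mul_le_of_le_threshold hm hc)
        have hmb : ((m : ℝ) - 1) * (m * b ^ 2) = 1 := by
          have h := hsq
          rw [heq] at h
          linarith
        have e1 : (m : ℝ) * a ^ 2 = m - 1 := by rw [heq]; linear_combination ((m : ℝ) - 1) * hmb
        have e2 : (m : ℝ) * b ^ 2 = ((m : ℝ) - 1)⁻¹ := by field_simp; linarith
        refine mul_right_cancel₀ hlog ((srmInformation_mul_log hm hab).trans ?_)
        rw [e1, e2, Real.log_inv, Real.logb, heq]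
        field_simp
        ring
      · have : m * (1 - r₀) = (m - 1) * (a - b) ^ 2 := by
          rw [hab.sq_sub hr₁]; linear_combination -(m : ℝ) * hr
        rw [this]
        ring
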